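/- **Definitions.** A *block palindrome* is a factorization $f=f_{-n}\cdots f_{-1}f_0f_1\cdots f_n$ ($n\ge 0$) of a string such that $f_{-i}=f_i$ is non-empty for $1\le i\le n$, while the center block $f_0$ may be empty. Its size $\|f\|$ is the number of its non-empty blocks, and $|f|$ is the total length of its blocks. It is *largest* if no block palindrome that factorizes the same string has more blocks. Let $T$ be a string of length $N$. For a center position $c\in\{1,\tfrac32,2,\dots,N\}$ and an integer $d\ge1$, let $F_T(c,d)$ be the set of the largest block palindromes occurring in $T$ whose center block $f_0$ is the occurrence $T[\lceil c-d+1\rceil\ldots\lfloor c+d-1\rfloor]$ in $T$ (which is empty if $c\notin\mathbb{Z}$ and $d=1$). A longest element of $F_T(c,d)$ is a *maximal block palindrome* of $T$. $\mathit{MBP}(T)$ is the set of all of these occurrences, over all $c$ and $d$, and $\|\mathit{MBP}(T)\|$ is the sum of their sizes. **Theorem.** There is an algorithm that, given a string $T$ of length $N$ over an integer alphabet, enumerates all maximal block palindromes that appear in $T$, each exactly once, in $O(N+\|\mathit{MBP}(T)\|)$ time. Here time is the number of instructions of a fixed program on a word RAM with word length $w\ge e\log_2(N+2)$ for a suitable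 constant $e$, each letter of $T$ being an integer that fits into one word. Each maximal block palindrome is written out as its size followed by the list of the boundaries of its non-empty blocks in $T$. The program and the constants do not depend on $T$, $N$, $w$ or the alphabet. -/

import Mathlib

/-! ## Block palindromes -/

/-- A block palindrome `f₋ₙ ⋯ f₋₁ f₀ f₁ ⋯ fₙ` with `f₋ᵢ = fᵢ`: the center block `f₀` is a string,
possibly empty, and `arms = [f₁, …, fₙ]` (from the inside outwards) are non-empty strings. -/
structure BlockPal (α : Type*) where
  center : List α
  arms : List (List α)
  arms_ne_nil : ∀ b ∈ arms, b ≠ []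

namespace BlockPal

variable {α : Type*}

/-- All blocks from left to right: `[f₋ₙ, …, f₋₁, f₀, f₁, …, fₙ]`. -/
def blocks (f : BlockPal α) : List (List α) :=
  f.arms.reverse ++ f.center :: f.arms

/-- The string of which `f` is a factorization. -/
def str (f : BlockPal α) : List α := f.blocks.flatten

/-- The length `|f|`. -/
def length (f : BlockPal α) : ℕ := f.str.length

/-- `|f₁ ⋯ fₙ|`. -/
def armLength (f : BlockPal α) : ℕ := f.arms.flatten.length

/-- The non-empty blocks from left to right. -/
def nonemptyBlocks (f : BlockPal α) : List (List α) :=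
  f.blocks.filter (fun b => !b.isEmpty)

/-- The size `‖f‖`: the number of non-empty blocks. -/
def size (f : BlockPal α) : ℕ := f.nonemptyBlocks.length

/-- `f` is the largest block palindrome of its string: it has the largest number of blocks among
all block palindromes that are factorizations of the same string. -/
def IsLargest (f : BlockPal α) : Prop :=
  ∀ g : BlockPal α, g.str = f.str → g.size ≤ f.size

/-- `f` occurs in `T` from offset `s` on: `T = x f y` with `|x| = s`. -/
def OccursAt (T : List α) (s : ℕ) (f : BlockPal α) : Prop :=
  ∃ x y : List α, T = x ++ f.str ++ y ∧ x.length = s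

/-- The set `F_T(c, d)`, whose elements are recorded together with the offset at which they occur.
The center block is required to be the occurrence `T[i+1 … j]` (positions counted from `1`), so
`c = (i + j + 1) / 2`, and `d ≥ 1` is determined by `j - i = 2 d - 1` (if `c` is an integer) or
`j - i = 2 d - 2` (otherwise). -/
def F (T : List α) (i j : ℕ) : Set (ℕ × BlockPal α) :=
  {o | o.2.IsLargest ∧ OccursAt T o.1 o.2 ∧
    o.1 + o.2.armLength = i ∧ i + o.2.center.length = j}

/-- The maximal block palindromes in `T` (with their offsets): the longest elements of the sets
`F_T(c, d)`, over all center positions `1 ≤ c ≤ |T|`, where `2 c = i + j + 1`. -/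
def MBP (T : List α) : Set (ℕ × BlockPal α) :=
  {o | ∃ i j : ℕ, 2 ≤ i + j + 1 ∧ i + j + 1 ≤ 2 * T.length ∧
    o ∈ F T i j ∧ ∀ o' ∈ F T i j, o'.2.length ≤ o.2.length}

/-- `‖MBP(T)‖`: the sum of the sizes of all maximal block palindromes in `T`. -/
noncomputable def totalSize (T : List α) : ℕ :=
  ∑ᶠ o ∈ MBP T, o.2.size

/-- How a block palindrome `f` occurring at offset `s` is written down: its size `m`, followed by
the `m + 1` boundaries `s = p₀ < p₁ < ⋯ < pₘ` of its non-empty blocks, which are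
`T[p₀+1 … p₁], …, T[pₘ₋₁+1 … pₘ]`. -/
def encode (o : ℕ × BlockPal α) : List ℕ :=
  o.2.size :: List.scanl (· + ·) o.1 (o.2.nonemptyBlocks.map List.length)

end BlockPal

/-! ## The word RAM -/

namespace WordRAM

/-- Instructions. Registers are numbered; `l` is a position in the program. -/
inductive Instr where
  /-- `R[d] := v` -/
  | const (d v : ℕ)
  /-- `R[d] := R[a]` -/
  | copy (d a : ℕ)
  /-- `R[d] := R[a] + R[b]` -/
  | add (d a b : ℕ)
  /-- `R[d] := R[a] - R[b]` -/
  | sub (d a b : ℕ)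
  /-- `R[d] := R[a] * R[b]` -/
  | mul (d a b : ℕ)
  /-- `R[d] := M[R[a]]` -/
  | load (d a : ℕ)
  /-- `M[R[a]] := R[b]` -/
  | store (a b : ℕ)
  /-- go to `l` -/
  | jump (l : ℕ)
  /-- if `R[a] = R[b]` go to `l` -/
  | jumpEq (a b l : ℕ)
  /-- if `R[a] < R[b]` go to `l` -/
  | jumpLt (a b l : ℕ)
  /-- append `R[a]` to the output -/
  | out (a : ℕ)

/-- A program is a finite list of instructions. -/
abbrev Program := List Instr

/-- A configuration: program counter, registers, random-access memory, output written so far. -/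
structure State where
  pc : ℕ
  reg : ℕ → ℕ
  mem : ℕ → ℕ
  output : List ℕ

/-- Put the `w`-bit word congruent to `v` into register `d` and go on with the next instruction. -/
def State.setReg (w : ℕ) (s : State) (d v : ℕ) : State :=
  { s with pc := s.pc + 1, reg := Function.update s.reg d (v % 2 ^ w) }

/-- One step of a machine with `w`-bit words (arithmetic is modulo `2 ^ w`). The machine has halted,
and its configuration does not change any more, when the program counter is outside the program. -/
def step (w : ℕ) (P : Program) (s : State) : State :=
  match P[s.pc]? with
  | none => s
  | some (.const d v) => s.setReg w d v
  | some (.copy d a) => s.setReg w d (s.reg a)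
  | some (.add d a b) => s.setReg w d (s.reg a + s.reg b)
  | some (.sub d a b) => s.setReg w d (s.reg a + (2 ^ w - s.reg b))
  | some (.mul d a b) => s.setReg w d (s.reg a * s.reg b)
  | some (.load d a) => s.setReg w d (s.mem (s.reg a))
  | some (.store a b) =>
      { s with pc := s.pc + 1, mem := Function.update s.mem (s.reg a) (s.reg b) }
  | some (.jump l) => { s with pc := l }
  | some (.jumpEq a b l) => { s with pc := if s.reg a = s.reg b then l else s.pc + 1 }
  | some (.jumpLt a b l) => { s with pc := if s.reg a < s.reg b then l else s.pc + 1 }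
  | some (.out a) => { s with pc := s.pc + 1, output := s.output ++ [s.reg a] }

/-- The initial configuration on input `T`: memory cell `0` holds the length of `T`, the cells
`1, …, |T|` hold the letters of `T`, and everything else is `0`. -/
def init (T : List ℕ) : State where
  pc := 0
  reg := fun _ => 0
  mem := fun a => if a = 0 then T.length else T.getD (a - 1) 0
  output := []

/-- On a machine with `w`-bit words and input `T`, the program `P` halts after at most `t` steps,
having written the output `y`. Each instruction costs one step. -/
def HaltsWithin (w : ℕ) (P : Program) (T : List ℕ) (t : ℕ) (y : List ℕ) : Prop :=
  ∃ k ≤ t, P.length ≤ ((step w P)^[k] (init T)).pc ∧ ((step w P)^[k] (init T)).output = y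

end WordRAM

/-! A block palindrome is largest exactly when none of its blocks is bordered: a bordered block can
be split further, and a factorization into unbordered blocks is unique, because of two different
outermost blocks the shorter would be a border of the longer (`isLargest_iff`). Hence the largest
block palindromes with a fixed center are the initial parts of one of them, obtained by repeatedly
extending the center outwards by the shortest string that matches on both sides. The maximal block
palindromes thus correspond to the unbordered centers, empty ones included (`mem_MBP_iff`).

Extending outwards is inverse to stripping the shortest border (`extension_eq_iff`). Stripping
repeatedly leads from any non-empty substring to an unbordered center, so all `N (N + 1) / 2` of
them lie on the extension chains of the centers. A chain has at most `‖f‖ + 1` members, and at most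
`N` centers are empty. Therefore `‖MBP(T)‖` is at least quadratic in `N`, up to a linear term
(`mul_succ_le_totalSize`), and quadratic time is affordable.

The program computes the longest and shortest borders of all prefixes of every suffix by the
Knuth–Morris–Pratt method. A bordered prefix supplies one entry of the table of extensions. An
unbordered one is a center, and its arms are read off that table: the extensions needed all begin
further left, in suffixes already treated (`MemInv.table`). The scan is bounded by a potential
(`loopFinishes`); writing is charged to the output. -/

namespace BlockPal

variable {α : Type*}

/-! ### Unbordered blocks and largest block palindromes -/

/-- A string with a non-empty border that does not overlap itself. -/
def Bordered (w : List α) : Prop := ∃ b x : List α, b ≠ [] ∧ w = b ++ x ++ b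

/-- If the two occurrences of `b` overlap, their overlap is a shorter prefix and suffix of `w`;
descend until there is no overlap. -/
theorem bordered_of_prefix_of_suffix {b w : List α} (hb : b ≠ []) (hlen : b.length < w.length)
    (hp : b <+: w) (hs : b <:+ w) : Bordered w := by
  induction hn : b.length using Nat.strong_induction_on generalizing b with
  | _ n ih =>
    obtain ⟨z, rfl⟩ := hp
    obtain ⟨y, hy⟩ := hs
    have hl := congrArg List.length hy
    simp only [List.length_append] at hl hlen
    rcases le_total b.length z.length with h | h
    · have : b <:+ z := List.suffix_of_suffix_length_le ⟨y, hy⟩ (List.suffix_append b z) h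
      obtain ⟨x, rfl⟩ := this
      exact ⟨b, x, hb, by simp⟩
    · obtain ⟨c, hc⟩ : y <+: b :=
        List.prefix_of_prefix_length_le ⟨b, hy⟩ (List.prefix_append b z) (by omega)
      have hcz : b = c ++ z := by
        have : y ++ b = y ++ (c ++ z) := by rw [hy, ← List.append_assoc, hc]
        exact List.append_cancel_left this
      have hcl := congrArg List.length hc
      simp only [List.length_append] at hcl
      rcases eq_or_ne c [] with rfl | hc0
      · exact ⟨b, [], hb, by simp_all⟩
      · refine ih c.length (by omega) hc0 ?_ ?_ ?_ rfl
        · simp only [List.length_append]; omega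
        · exact ⟨z ++ z, by rw [← List.append_assoc, ← hcz]⟩
        · exact ⟨y ++ y, by rw [← hy, List.append_assoc, hc]⟩

theorem str_eq (f : BlockPal α) :
    f.str = f.arms.reverse.flatten ++ f.center ++ f.arms.flatten := by
  simp [str, blocks]

theorem nonemptyBlocks_eq (f : BlockPal α) :
    f.nonemptyBlocks = f.arms.reverse ++ (if f.center.isEmpty then [] else [f.center]) ++ f.arms := by
  have h : ∀ A : List (List α), (∀ b ∈ A, b ≠ []) → A.filter (fun b => !b.isEmpty) = A :=
    fun A hA => List.filter_eq_self.2 fun b hb => by simpa using hA b hb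
  simp only [nonemptyBlocks, blocks, List.filter_append, List.filter_cons]
  rw [h f.arms f.arms_ne_nil, h f.arms.reverse fun b hb => f.arms_ne_nil b (by simpa using hb)]
  cases f.center.isEmpty <;> simp

theorem size_eq (f : BlockPal α) : f.size = 2 * f.arms.length + min 1 f.center.length := by
  rw [size, nonemptyBlocks_eq]
  cases f.center <;> simp <;> omega

theorem length_arms_le {A : List (List α)} (hA : ∀ b ∈ A, b ≠ []) : A.length ≤ A.flatten.length := by
  induction A with
  | nil => simp
  | cons a A ih =>
    have ha : 0 < a.length := List.length_pos_iff.2 (hA a (by simp))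
    have := ih fun b hb => hA b (by simp [hb])
    simp only [List.length_cons, List.flatten_cons, List.length_append]
    omega

theorem length_reverse_flatten (A : List (List α)) :
    A.reverse.flatten.length = A.flatten.length := by
  induction A with
  | nil => rfl
  | cons a A ih =>
    simp only [List.reverse_cons, List.flatten_append, List.flatten_cons, List.length_append, ih,
      List.flatten_nil, List.length_nil]
    omega

theorem size_le_length (f : BlockPal α) : f.size ≤ f.str.length := by
  have h := length_arms_le f.arms_ne_nil
  rw [size_eq, str_eq, List.length_append, List.length_append, length_reverse_flatten]
  omega

theorem IsLargest.not_bordered_center {f : BlockPal α} (hf : f.IsLargest) :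
    ¬ Bordered f.center := by
  rintro ⟨b, x, hb, hc⟩
  have h := hf ⟨x, b :: f.arms, by
    intro c hc
    rcases List.mem_cons.1 hc with rfl | hc
    exacts [hb, f.arms_ne_nil c hc]⟩ (by simp [str_eq, hc])
  simp only [size_eq, List.length_cons] at h
  omega

theorem IsLargest.not_bordered_arm {f : BlockPal α} (hf : f.IsLargest) :
    ∀ u ∈ f.arms, ¬ Bordered u := by
  rintro u hu ⟨b, x, hb, rfl⟩
  obtain ⟨A, B, hAB⟩ := List.append_of_mem hu
  have hne := f.arms_ne_nil
  rw [hAB] at hne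
  -- The arm is cut into `b, x, b`; an empty `x` must be left out, since arms are non-empty.
  rcases eq_or_ne x [] with rfl | hx
  · have h := hf ⟨f.center, A ++ [b, b] ++ B, by
      intro c hc
      simp only [List.mem_append, List.mem_cons, List.not_mem_nil, or_false, or_self] at hc
      rcases hc with (hc | rfl) | hc
      exacts [hne c (by simp [hc]), hb, hne c (by simp [hc])]⟩ (by simp [str_eq, hAB])
    simp only [size_eq, hAB, List.length_append, List.length_cons, List.length_nil] at h
    omega
  · have h := hf ⟨f.center, A ++ [b, x, b] ++ B, by
      intro c hc
      simp only [List.mem_append, List.mem_cons, List.not_mem_nil, or_false] at hc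
      rcases hc with (hc | rfl | rfl | rfl) | hc
      exacts [hne c (by simp [hc]), hb, hx, hb, hne c (by simp [hc])]⟩ (by simp [str_eq, hAB])
    simp only [size_eq, hAB, List.length_append, List.length_cons, List.length_nil] at h
    omega

/-- Outermost blocks of different lengths would make the shorter a border of the longer. They are
therefore equal and can be cancelled. The induction removes the last arm, which is the outermost. -/
theorem unbordered_factorization_unique {A B : List (List α)} {c d : List α}
    (hA : ∀ u ∈ A, u ≠ [] ∧ ¬ Bordered u) (hB : ∀ u ∈ B, u ≠ [] ∧ ¬ Bordered u)
    (hc : ¬ Bordered c) (hd : ¬ Bordered d)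
    (h : A.reverse.flatten ++ c ++ A.flatten = B.reverse.flatten ++ d ++ B.flatten) :
    A = B ∧ c = d := by
  induction A using List.reverseRecOn generalizing B with
  | nil =>
    rcases List.eq_nil_or_concat B with rfl | ⟨B, v, rfl⟩
    · simpa using h
    · refine absurd ⟨v, B.reverse.flatten ++ d ++ B.flatten, (hB v (by simp)).1, ?_⟩ hc
      simpa using h
  | append_singleton A u ih =>
    rcases List.eq_nil_or_concat B with rfl | ⟨B, v, rfl⟩
    · refine absurd ⟨u, A.reverse.flatten ++ c ++ A.flatten, (hA u (by simp)).1, ?_⟩ hd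
      simpa using h.symm
    · obtain ⟨hu, hu'⟩ := hA u (by simp)
      obtain ⟨hv, hv'⟩ := hB v (by simp)
      replace h : u ++ (A.reverse.flatten ++ c ++ A.flatten) ++ u =
          v ++ (B.reverse.flatten ++ d ++ B.flatten) ++ v := by simpa using h
      set x := A.reverse.flatten ++ c ++ A.flatten
      set y := B.reverse.flatten ++ d ++ B.flatten
      have aux : ∀ {u v x y : List α}, u ≠ [] → ¬ Bordered v → u ++ x ++ u = v ++ y ++ v →
          v.length ≤ u.length := by
        intro u v x y hu hv h
        by_contra! hlt
        refine hv (bordered_of_prefix_of_suffix hu hlt ?_ ?_)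
        · exact List.prefix_of_prefix_length_le ⟨x ++ u, by rw [← List.append_assoc, h]⟩
            ⟨y ++ v, by rw [List.append_assoc]⟩ hlt.le
        · exact List.suffix_of_suffix_length_le ⟨u ++ x, h⟩ ⟨v ++ y, rfl⟩ hlt.le
      have hl : u.length = v.length := le_antisymm (aux hv hu' h.symm) (aux hu hv' h)
      obtain ⟨h1, rfl⟩ := List.append_inj' h hl
      obtain ⟨-, h2⟩ := List.append_inj h1 rfl
      obtain ⟨rfl, rfl⟩ := ih (fun w hw => hA w (by simp [hw])) (fun w hw => hB w (by simp [hw])) h2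
      exact ⟨by simp, rfl⟩

/-- For the converse, sizes are bounded by the length, so some factorization `g` of the same string
is largest; its blocks are unbordered, and uniqueness identifies it with `f`. -/
theorem isLargest_iff (f : BlockPal α) :
    f.IsLargest ↔ (∀ u ∈ f.arms, ¬ Bordered u) ∧ ¬ Bordered f.center := by
  refine ⟨fun h => ⟨h.not_bordered_arm, h.not_bordered_center⟩, fun ⟨hA, hc⟩ => ?_⟩
  have hfin : {n | ∃ g : BlockPal α, g.str = f.str ∧ g.size = n}.Finite :=
    (Set.finite_Iic f.str.length).subset (by
      rintro n ⟨g, hg, rfl⟩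
      exact hg ▸ g.size_le_length)
  obtain ⟨n, ⟨g, hg, rfl⟩, hmax⟩ := hfin.exists_maximal ⟨_, f, rfl, rfl⟩
  have hmax' : ∀ g' : BlockPal α, g'.str = f.str → g'.size ≤ g.size := fun g' h' => by
    by_contra! hlt
    exact absurd (hmax ⟨g', h', rfl⟩ hlt.le) (by omega)
  have hgl : g.IsLargest := fun g' h' => hmax' g' (h'.trans hg)
  have heq := unbordered_factorization_unique (A := f.arms) (B := g.arms)
    (fun u hu => ⟨f.arms_ne_nil u hu, hA u hu⟩)
    (fun u hu => ⟨g.arms_ne_nil u hu, hgl.not_bordered_arm u hu⟩) hc hgl.not_bordered_center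
    (by rw [← str_eq, ← str_eq, hg])
  intro g' h'
  refine (hmax' g' h').trans ?_
  rw [size_eq, size_eq, heq.1, heq.2]

end BlockPal

/-! ### Borders and outward extensions in terms of positions -/

namespace BlockPal

variable {α : Type*}

/-- `T[i+1 … i+l] = T[k+1 … k+l]`, compared letter by letter. -/
def MatchAt (T : List α) (i k l : ℕ) : Prop := ∀ t < l, T[i + t]? = T[k + t]?

/-- `T[i+1 … i+m]` has a border of length `l < m` (possibly `0`). -/
def IsBorder (T : List α) (i m l : ℕ) : Prop := l < m ∧ MatchAt T i (i + (m - l)) l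

/-- The length of the shortest non-empty border of `T[i+1 … i+m]`, or `0` if there is none. -/
noncomputable def shortestBorder (T : List α) (i m : ℕ) : ℕ :=
  sInf {l | 0 < l ∧ IsBorder T i m l}

/-- The length of the shortest non-empty string that occurs in `T` both immediately before position
`i` and immediately after position `j`, or `0` if there is none. -/
noncomputable def extension (T : List α) (i j : ℕ) : ℕ :=
  sInf {l | 0 < l ∧ l ≤ i ∧ j + l ≤ T.length ∧ MatchAt T (i - l) j l}

theorem isLeast_of_sInf_pos {p : ℕ → Prop} (h : 0 < sInf {l | p l}) :
    p (sInf {l | p l}) ∧ ∀ l < sInf {l | p l}, ¬ p l :=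
  ⟨Nat.sInf_mem (Nat.nonempty_of_pos_sInf h), fun _ hl => Nat.notMem_of_lt_sInf hl⟩

theorem sInf_eq_of_isLeast {p : ℕ → Prop} {n : ℕ} (hn : p n) (h : ∀ l < n, ¬ p l) :
    sInf {l | p l} = n :=
  IsLeast.csInf_eq ⟨hn, fun l hl => not_lt.1 fun hlt => h l hlt hl⟩

variable {T : List α} {i j k m b c l : ℕ}

theorem shortestBorder_eq_zero :
    shortestBorder T i m = 0 ↔ ∀ l, 0 < l → ¬ IsBorder T i m l := by
  rw [shortestBorder, Nat.sInf_eq_zero, Set.eq_empty_iff_forall_notMem]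
  simp

theorem shortestBorder_eq (hl : 0 < l) :
    shortestBorder T i m = l ↔
      IsBorder T i m l ∧ ∀ l', 0 < l' → l' < l → ¬ IsBorder T i m l' := by
  constructor
  · rintro rfl
    have := isLeast_of_sInf_pos hl
    exact ⟨this.1.2, fun l' h0 h1 h2 => this.2 l' h1 ⟨h0, h2⟩⟩
  · exact fun h => sInf_eq_of_isLeast ⟨hl, h.1⟩ fun l' h1 h2 => h.2 l' h2.1 h1 h2.2

theorem extension_eq (hl : 0 < l) :
    extension T i j = l ↔ (l ≤ i ∧ j + l ≤ T.length ∧ MatchAt T (i - l) j l) ∧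
      ∀ l', 0 < l' → l' < l → ¬ MatchAt T (i - l') j l' := by
  constructor
  · rintro rfl
    have := isLeast_of_sInf_pos hl
    have h3 := this.1.2
    refine ⟨this.1.2, fun l' h0 h1 h2 => this.2 l' h1 ⟨h0, ?_, ?_, h2⟩⟩
    · exact h1.le.trans h3.1
    · exact (Nat.add_le_add_left h1.le _).trans h3.2.1
  · exact fun h => sInf_eq_of_isLeast ⟨hl, h.1⟩ fun l' h1 h2 => h.2 l' h2.1 h1 h2.2.2.2

theorem isBorder_zero (hm : 0 < m) : IsBorder T i m 0 := ⟨hm, fun t ht => by omega⟩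

theorem isBorder_succ_succ : IsBorder T i (m + 1) (c + 1) ↔
    IsBorder T i m c ∧ T[i + c]? = T[i + m]? := by
  constructor
  · rintro ⟨h1, h2⟩
    refine ⟨⟨by omega, fun t ht => ?_⟩, ?_⟩
    · simpa using h2 t (by omega)
    · have := h2 c (by omega)
      rwa [show i + (m + 1 - (c + 1)) + c = i + m by omega] at this
  · rintro ⟨⟨h1, h2⟩, h3⟩
    refine ⟨by omega, fun t ht => ?_⟩
    rcases Nat.lt_succ_iff_lt_or_eq.1 ht with ht | rfl
    · simpa using h2 t ht
    · rwa [show i + (m + 1 - (t + 1)) + t = i + m by omega]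

/-- `T[i+1 … i+m]` ends with a copy of `T[i+1 … i+b]`, so the two have the same suffix of length
`c`. -/
theorem IsBorder.trans_iff (hb : IsBorder T i m b) (hc : c < b) :
    IsBorder T i m c ↔ IsBorder T i b c := by
  have key : ∀ t < c, T[i + (b - c) + t]? = T[i + (m - c) + t]? := fun t ht => by
    have h := hb.2 (b - c + t) (by omega)
    have := hb.1
    rwa [show i + (b - c + t) = i + (b - c) + t by omega,
      show i + (m - b) + (b - c + t) = i + (m - c) + t by omega] at h
  constructor
  · exact fun h => ⟨hc, fun t ht => (h.2 t ht).trans (key t ht).symm⟩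
  · exact fun h => ⟨hc.trans hb.1, fun t ht => (h.2 t ht).trans (key t ht)⟩

theorem IsBorder.overlap (hb : IsBorder T i m b) (h : m < 2 * b) : IsBorder T i m (2 * b - m) := by
  have hbm := hb.1
  refine ⟨by omega, fun t ht => ?_⟩
  rw [hb.2 t (by omega), show i + (m - b) + t = i + (m - b + t) by omega,
    hb.2 (m - b + t) (by omega)]
  congr 1
  omega

theorem two_mul_shortestBorder_le : 2 * shortestBorder T i m ≤ m := by
  by_contra! h
  have h0 : 0 < shortestBorder T i m := by omega
  obtain ⟨h1, h2⟩ := (shortestBorder_eq h0).1 rfl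
  have := h1.1
  exact h2 _ (by omega) (by omega) (h1.overlap h)

/-- All other borders are borders of the longest one. This makes shortest borders computable along
with the longest ones. -/
theorem shortestBorder_of_longest (hb : IsBorder T i m b) (h : ∀ c, IsBorder T i m c → c ≤ b) :
    shortestBorder T i m = if shortestBorder T i b = 0 then b else shortestBorder T i b := by
  rcases Nat.eq_zero_or_pos b with rfl | hb0
  · have h1 : shortestBorder T i m = 0 := shortestBorder_eq_zero.2 fun l hl hl' => by
      have := h l hl'; omega
    have h2 : shortestBorder T i 0 = 0 := shortestBorder_eq_zero.2 fun l hl hl' => by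
      have := hl'.1; omega
    simp [h1, h2]
  split_ifs with h0
  · refine (shortestBorder_eq hb0).2 ⟨hb, fun l h1 h2 h3 => ?_⟩
    exact shortestBorder_eq_zero.1 h0 l h1 ((hb.trans_iff h2).1 h3)
  · have hpos := Nat.pos_of_ne_zero h0
    obtain ⟨h1, h2⟩ := (shortestBorder_eq hpos).1 (rfl : shortestBorder T i b = _)
    refine (shortestBorder_eq hpos).2 ⟨(hb.trans_iff h1.1).2 h1, fun l h3 h4 h5 => ?_⟩
    exact h2 l h3 h4 ((hb.trans_iff (h4.trans h1.1)).1 h5)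

/-- Both sides say that the common string `T[j+1 … j+l]` has a border of length `k`. -/
theorem matchAt_inner_iff (h : MatchAt T (i - l) j l) (hli : l ≤ i) (hlk : k < l) :
    MatchAt T (i - k) j k ↔ MatchAt T (i - l) (j + l - k) k := by
  have h1 : ∀ t < k, T[i - k + t]? = T[j + l - k + t]? := fun t ht => by
    have := h (l - k + t) (by omega)
    rwa [show i - l + (l - k + t) = i - k + t by omega,
      show j + (l - k + t) = j + l - k + t by omega] at this
  have h2 : ∀ t < k, T[i - l + t]? = T[j + t]? := fun t ht => h t (by omega)
  constructor
  · exact fun h3 t ht => by rw [h2 t ht, ← h3 t ht, h1 t ht]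
  · exact fun h3 t ht => by rw [h1 t ht, ← h3 t ht, h2 t ht]

/-- Extending outwards is inverse to stripping the shortest border. -/
theorem extension_eq_iff (hl : 0 < l) (hli : l ≤ i) (hij : i ≤ j) (hj : j + l ≤ T.length) :
    extension T i j = l ↔ shortestBorder T (i - l) (j - i + 2 * l) = l := by
  have hb : ∀ {l'}, l' ≤ l → (IsBorder T (i - l) (j - i + 2 * l) l' ↔
      MatchAt T (i - l) (j + l - l') l') := fun {l'} h => by
    rw [IsBorder, show i - l + (j - i + 2 * l - l') = j + l - l' by omega]
    exact and_iff_right (by omega)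
  rw [extension_eq hl, shortestBorder_eq hl, hb le_rfl, Nat.add_sub_cancel]
  constructor
  · rintro ⟨⟨-, -, h⟩, h'⟩
    refine ⟨h, fun l' h1 h2 h3 => h' l' h1 h2 ?_⟩
    exact (matchAt_inner_iff h hli h2).2 ((hb h2.le).1 h3)
  · rintro ⟨h, h'⟩
    refine ⟨⟨hli, hj, h⟩, fun l' h1 h2 h3 => h' l' h1 h2 ?_⟩
    exact (hb h2.le).2 ((matchAt_inner_iff h hli h2).1 h3)

theorem extension_le : extension T i j ≤ i := by
  rcases Nat.eq_zero_or_pos (extension T i j) with h | h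
  · omega
  · exact ((extension_eq h).1 rfl).1.1

theorem add_extension_le (hj : j ≤ T.length) : j + extension T i j ≤ T.length := by
  rcases Nat.eq_zero_or_pos (extension T i j) with h | h
  · omega
  · exact ((extension_eq h).1 rfl).1.2.1

end BlockPal

/-! ### Maximal block palindromes as extensions of unbordered centers -/

namespace BlockPal

variable {α : Type*} {T : List α} {i j k m l : ℕ}

theorem take_drop_eq_iff :
    (T.drop i).take l = (T.drop k).take l ↔ MatchAt T i k l := by
  constructor
  · intro h t ht
    have := congrArg (·[t]?) h
    simpa [ht] using this
  · intro h
    refine List.ext_getElem? fun t => ?_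
    by_cases ht : t < l
    · simpa [ht] using h t ht
    · simp [ht]

/-- `Bordered` forbids overlap and `IsBorder` does not; `bordered_of_prefix_of_suffix` bridges the
difference. -/
theorem bordered_take_drop_iff (h : i + m ≤ T.length) :
    Bordered ((T.drop i).take m) ↔ shortestBorder T i m ≠ 0 := by
  have hlen : ((T.drop i).take m).length = m := by simp; omega
  constructor
  · rintro ⟨b, x, hb, hw⟩ h0
    have hbl := List.length_pos_iff.2 hb
    have hm : m = b.length + x.length + b.length := by
      rw [← hlen, hw, List.length_append, List.length_append]
    refine shortestBorder_eq_zero.1 h0 b.length hbl ⟨by omega, take_drop_eq_iff.1 ?_⟩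
    have h1 : (T.drop i).take b.length = b := by
      have := congrArg (List.take b.length) hw
      rwa [List.take_take, min_eq_left (by omega), List.append_assoc, List.take_left] at this
    have h2 : (T.drop (i + (m - b.length))).take b.length = b := by
      have := congrArg (List.drop (m - b.length)) hw
      rw [List.drop_take, List.drop_drop, show m - (m - b.length) = b.length by omega,
        List.drop_left' (by simp; omega)] at this
      exact this
    rw [h1, h2]
  · intro h0
    have hpos := Nat.pos_of_ne_zero h0
    obtain ⟨⟨h1, h2⟩, -⟩ := (shortestBorder_eq hpos).1 rfl
    set s := shortestBorder T i m
    refine bordered_of_prefix_of_suffix (b := (T.drop i).take s) ?_ ?_ ?_ ?_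
    · rw [ne_eq, ← List.length_eq_zero_iff]; simp; omega
    · rw [hlen]; simp; omega
    · rw [show (T.drop i).take s = ((T.drop i).take m).take s by
        rw [List.take_take, min_eq_left h1.le]]
      exact List.take_prefix _ _
    · rw [take_drop_eq_iff.2 h2]
      have : ((T.drop i).take m).drop (m - s) = (T.drop (i + (m - s))).take s := by
        rw [List.drop_take, List.drop_drop, show m - (m - s) = s by omega]
      rw [← this]
      exact List.drop_suffix _ _

/-- The lengths of the arms obtained by extending `T[i+1 … j]` outwards as long as possible. -/
noncomputable def armLengths (T : List α) (i j : ℕ) : List ℕ :=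
  if _ : extension T i j = 0 then []
  else extension T i j :: armLengths T (i - extension T i j) (j + extension T i j)
termination_by i
decreasing_by
  have := extension_le (T := T) (i := i) (j := j)
  omega

/-- The arms obtained by extending `T[i+1 … j]` outwards as long as possible. -/
noncomputable def armsFrom (T : List α) (i j : ℕ) : List (List α) :=
  if _ : extension T i j = 0 then []
  else (T.drop j).take (extension T i j) ::
    armsFrom T (i - extension T i j) (j + extension T i j)
termination_by i
decreasing_by
  have := extension_le (T := T) (i := i) (j := j)
  omega

theorem armLengths_of_eq_zero (h : extension T i j = 0) : armLengths T i j = [] := by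
  rw [armLengths, dif_pos h]

theorem armLengths_of_eq (hl : 0 < l) (h : extension T i j = l) :
    armLengths T i j = l :: armLengths T (i - l) (j + l) := by
  rw [armLengths, dif_neg (by omega), h]

theorem armsFrom_of_eq_zero (h : extension T i j = 0) : armsFrom T i j = [] := by
  rw [armsFrom, dif_pos h]

theorem armsFrom_of_eq (hl : 0 < l) (h : extension T i j = l) :
    armsFrom T i j = (T.drop j).take l :: armsFrom T (i - l) (j + l) := by
  rw [armsFrom, dif_neg (by omega), h]

/-- Induction along the outward extensions of `T[i+1 … j]`. -/
theorem extension_induction {p : ℕ → ℕ → Prop} (T : List α)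
    (zero : ∀ i j, extension T i j = 0 → p i j)
    (step : ∀ i j l, 0 < l → extension T i j = l → p (i - l) (j + l) → p i j) (i j : ℕ) : p i j := by
  induction i using Nat.strong_induction_on generalizing j with
  | _ i ih =>
    rcases Nat.eq_zero_or_pos (extension T i j) with h | h
    · exact zero i j h
    · have := extension_le (T := T) (i := i) (j := j)
      exact step i j _ h rfl (ih _ (by omega) _)

theorem map_length_armsFrom (i j : ℕ) : (armsFrom T i j).map List.length = armLengths T i j := by
  induction i, j using extension_induction T with
  | zero i j h => rw [armsFrom_of_eq_zero h, armLengths_of_eq_zero h, List.map_nil]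
  | step i j l hl h ih =>
    have := ((extension_eq hl).1 h).1
    rw [armsFrom_of_eq hl h, armLengths_of_eq hl h, List.map_cons, ih]
    congr 1
    simp
    omega

theorem sum_armLengths_le (i j : ℕ) : (armLengths T i j).sum ≤ i := by
  induction i, j using extension_induction T with
  | zero i j h => simp [armLengths_of_eq_zero h]
  | step i j l hl h ih =>
    have := ((extension_eq hl).1 h).1
    rw [armLengths_of_eq hl h, List.sum_cons]
    omega

theorem length_armLengths_le (i j : ℕ) : (armLengths T i j).length ≤ i := by
  induction i, j using extension_induction T with
  | zero i j h => simp [armLengths_of_eq_zero h]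
  | step i j l hl h ih =>
    have := ((extension_eq hl).1 h).1
    rw [armLengths_of_eq hl h, List.length_cons]
    omega

theorem armsFrom_ne_nil (i j : ℕ) : ∀ b ∈ armsFrom T i j, b ≠ [] := by
  induction i, j using extension_induction T with
  | zero i j h => simp [armsFrom_of_eq_zero h]
  | step i j l hl h ih =>
    rw [armsFrom_of_eq hl h]
    intro b hb
    rcases List.mem_cons.1 hb with rfl | hb
    · have := ((extension_eq hl).1 h).1
      rw [ne_eq, ← List.length_eq_zero_iff]
      simp
      omega
    · exact ih b hb

/-- Each arm is the shortest border of the substring it completes, and a border of it would be a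
shorter one. -/
theorem not_bordered_armsFrom (hij : i ≤ j) : ∀ b ∈ armsFrom T i j, ¬ Bordered b := by
  induction i, j using extension_induction T with
  | zero i j h => simp [armsFrom_of_eq_zero h]
  | step i j l hl h ih =>
    rw [armsFrom_of_eq hl h]
    intro b hb
    have h1 := ((extension_eq hl).1 h).1
    rcases List.mem_cons.1 hb with rfl | hb
    · rw [← take_drop_eq_iff.2 h1.2.2, bordered_take_drop_iff (by omega), not_not,
        shortestBorder_eq_zero]
      intro l' h0 h2
      have h3 := (extension_eq_iff hl h1.1 hij h1.2.1).1 h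
      obtain ⟨h4, h5⟩ := (shortestBorder_eq hl).1 h3
      exact h5 l' h0 h2.1 ((h4.trans_iff h2.1).2 h2)
    · exact ih (by omega) b hb

/-- The block palindrome with center `T[i+1 … j]` extended outwards as long as possible, with its
offset in `T`. -/
noncomputable def mbp (T : List α) (i j : ℕ) : ℕ × BlockPal α :=
  (i - (armLengths T i j).sum, ⟨(T.drop i).take (j - i), armsFrom T i j, armsFrom_ne_nil i j⟩)

theorem extension_eq_length {X u c Y : List α} (hu : u ≠ []) (hu' : ¬ Bordered u) :
    extension (X ++ u ++ c ++ u ++ Y) (X.length + u.length) (X.length + u.length + c.length) =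
      u.length := by
  have h1 : ∀ t < u.length, (X ++ u ++ c ++ u ++ Y)[X.length + t]? = u[t]? := fun t ht => by
    simp [List.getElem?_append, ht]
  have h2 : ∀ t < u.length,
      (X ++ u ++ c ++ u ++ Y)[X.length + u.length + c.length + t]? = u[t]? := fun t ht => by
    rw [List.getElem?_append_left (by simp; omega), List.getElem?_append_right (by simp; omega)]
    congr 1
    simp only [List.length_append]
    omega
  refine (extension_eq (List.length_pos_iff.2 hu)).2 ⟨⟨by omega, by simp; omega, ?_⟩, ?_⟩
  · intro t ht
    rw [Nat.add_sub_cancel, h1 t ht, h2 t ht]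
  · intro l h0 hl hm
    refine hu' (bordered_of_prefix_of_suffix (b := u.take l) ?_ ?_ (List.take_prefix _ _) ?_)
    · rw [ne_eq, ← List.length_eq_zero_iff, List.length_take]; omega
    · simp; omega
    · have : u.take l = u.drop (u.length - l) := by
        refine List.ext_getElem? fun t => ?_
        by_cases ht : t < l
        · rw [List.getElem?_take, if_pos ht, List.getElem?_drop, ← h2 t (by omega), ← hm t ht,
            ← h1 _ (by omega)]
          congr 1
          omega
        · rw [List.getElem?_take, if_neg ht, List.getElem?_eq_none]
          rw [List.length_drop]; omega
      rw [this]
      exact List.drop_suffix _ _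

/-- Unbordered arms leave no choice: a match shorter than the innermost arm would be a border of it
(`extension_eq_length`). That arm is absorbed into the center, and the argument repeats. -/
theorem prefix_armsFrom {A : List (List α)} (hA : ∀ u ∈ A, u ≠ [] ∧ ¬ Bordered u) (x c y : List α) :
    A <+: armsFrom (x ++ (A.reverse.flatten ++ c ++ A.flatten) ++ y) (x.length + A.flatten.length)
      (x.length + A.flatten.length + c.length) := by
  induction A generalizing c with
  | nil => simp
  | cons u A ih =>
    obtain ⟨hu, hu'⟩ := hA u (by simp)
    have h1 : x ++ ((u :: A).reverse.flatten ++ c ++ (u :: A).flatten) ++ y =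
        (x ++ A.reverse.flatten) ++ u ++ c ++ u ++ (A.flatten ++ y) := by simp
    have h2 : x ++ ((u :: A).reverse.flatten ++ c ++ (u :: A).flatten) ++ y =
        x ++ (A.reverse.flatten ++ (u ++ c ++ u) ++ A.flatten) ++ y := by simp
    have h3 : x.length + (u :: A).flatten.length =
        (x ++ A.reverse.flatten).length + u.length := by
      rw [List.length_append, length_reverse_flatten]; simp; omega
    have h4 := extension_eq_length (X := x ++ A.reverse.flatten) (c := c) (Y := A.flatten ++ y)
      hu hu'
    rw [← h1, ← h3] at h4
    rw [armsFrom_of_eq (List.length_pos_iff.2 hu) h4]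
    have h5 : (List.drop (x.length + (u :: A).flatten.length + c.length)
        (x ++ ((u :: A).reverse.flatten ++ c ++ (u :: A).flatten) ++ y)).take u.length = u := by
      rw [h1, h3, List.append_assoc (_ ++ _), List.drop_left' (by simp; omega), List.take_left]
    rw [h5, List.prefix_cons_inj, h2]
    convert ih (fun w hw => hA w (by simp [hw])) (u ++ c ++ u) using 2
    · simp; omega
    · simp; omega

theorem exists_eq_append_armsFrom (x c y : List α) (hT : T = x ++ c ++ y) (hi : i = x.length)
    (hj : j = i + c.length) :
    ∃ x' y', T = x' ++ ((armsFrom T i j).reverse.flatten ++ c ++ (armsFrom T i j).flatten) ++ y' ∧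
      x'.length = i - (armLengths T i j).sum := by
  induction i, j using extension_induction T generalizing x c y with
  | zero i j h =>
    exact ⟨x, y, by rw [armsFrom_of_eq_zero h]; simp [hT], by rw [armLengths_of_eq_zero h]; simp [hi]⟩
  | step i j l hl h ih =>
    have h1 := ((extension_eq hl).1 h).1
    have hlen : T.length = x.length + c.length + y.length := by simp [hT]; omega
    have hu : (T.drop j).take l = y.take l := by
      rw [hT, List.drop_left' (by simp; omega)]
    have hu' : x.drop (i - l) = y.take l := by
      rw [← hu, ← take_drop_eq_iff.2 h1.2.2, hT, List.append_assoc,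
        List.drop_append_of_le_length (by omega), List.take_left' (by simp; omega)]
    obtain ⟨x', y', hxy, hx'⟩ := ih (x.take (i - l)) (y.take l ++ c ++ y.take l) (y.drop l) (by
      conv_lhs => rw [hT, ← List.take_append_drop (i - l) x, hu', ← List.take_append_drop l y]
      simp) (by simp; omega) (by simp; omega)
    refine ⟨x', y', ?_, ?_⟩
    · rw [armsFrom_of_eq hl h, hu]
      conv_lhs => rw [hxy]
      simp
    · rw [hx', armLengths_of_eq hl h, List.sum_cons]
      omega

theorem armLength_mbp (i j : ℕ) : (mbp T i j).2.armLength = (armLengths T i j).sum := by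
  rw [mbp, armLength, List.length_flatten, map_length_armsFrom]

theorem length_eq (f : BlockPal α) : f.length = f.center.length + 2 * f.armLength := by
  rw [length, str_eq, armLength, List.length_append, List.length_append, length_reverse_flatten]
  omega

theorem mem_F {o : ℕ × BlockPal α} (ho : o ∈ F T i j) :
    i ≤ j ∧ j ≤ T.length ∧ o.2.center = (T.drop i).take (j - i) ∧ shortestBorder T i (j - i) = 0 ∧
      o.2.arms <+: armsFrom T i j := by
  obtain ⟨s, f⟩ := o
  obtain ⟨h1, ⟨x, y, hT, rfl⟩, h3, h4⟩ := ho
  simp only at h1 hT h3 h4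
  rw [isLargest_iff] at h1
  rw [str_eq] at hT
  rw [armLength] at h3
  have hp := prefix_armsFrom (fun u hu => ⟨f.arms_ne_nil u hu, h1.1 u hu⟩) x f.center y
  rw [h3, h4, ← hT] at hp
  have hlen := congrArg List.length hT
  simp only [List.length_append, length_reverse_flatten] at hlen
  have hc : f.center = (T.drop i).take (j - i) := by
    have : T = (x ++ f.arms.reverse.flatten) ++ (f.center ++ (f.arms.flatten ++ y)) := by
      rw [hT]; simp
    rw [this, List.drop_left' (by rw [List.length_append, length_reverse_flatten, h3]),
      List.take_left' (by omega)]
  refine ⟨by omega, by omega, hc, ?_, hp⟩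
  by_contra h0
  exact h1.2 (hc ▸ (bordered_take_drop_iff (by omega)).2 h0)

theorem mbp_mem_F (hij : i ≤ j) (hj : j ≤ T.length) (h : shortestBorder T i (j - i) = 0) :
    mbp T i j ∈ F T i j := by
  have hsum := sum_armLengths_le (T := T) i j
  have hc : ((T.drop i).take (j - i)).length = j - i := by simp; omega
  obtain ⟨x, y, hxy, hx⟩ := exists_eq_append_armsFrom (T := T) (i := i) (j := j) (T.take i)
    ((T.drop i).take (j - i)) (T.drop j) (by
      conv_lhs => rw [← List.take_append_drop i T, ← List.take_append_drop (j - i) (T.drop i),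
        List.drop_drop, show i + (j - i) = j by omega]
      simp) (by simp; omega) (by omega)
  refine ⟨?_, ?_, ?_, ?_⟩
  · rw [isLargest_iff]
    refine ⟨not_bordered_armsFrom hij, fun hb => ?_⟩
    exact (bordered_take_drop_iff (by omega)).1 hb h
  · exact ⟨x, y, by rw [str_eq]; exact hxy, hx⟩
  · rw [armLength_mbp, mbp]
    omega
  · simp only [mbp, hc]
    omega

theorem eq_of_flatten_length_le {A B : List (List α)} (hB : ∀ b ∈ B, b ≠ []) (h : A <+: B)
    (hl : B.flatten.length ≤ A.flatten.length) : A = B := by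
  obtain ⟨C, rfl⟩ := h
  have := length_arms_le (A := C) fun b hb => hB b (by simp [hb])
  rw [List.flatten_append, List.length_append] at hl
  have : C = [] := List.length_eq_zero_iff.1 (by omega)
  simp [this]

/-- Given `i ≤ j ≤ T.length`, the range of center positions excludes only the empty strings at the
two ends of `T`. -/
theorem mem_MBP_iff {o : ℕ × BlockPal α} :
    o ∈ MBP T ↔ ∃ i j, i ≤ j ∧ j ≤ T.length ∧ 0 < j ∧ i < T.length ∧
      shortestBorder T i (j - i) = 0 ∧ o = mbp T i j := by
  constructor
  · rintro ⟨i, j, h1, h2, ho, hmax⟩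
    obtain ⟨h3, h4, h5, h6, h7⟩ := mem_F ho
    refine ⟨i, j, h3, h4, by omega, by omega, h6, ?_⟩
    have h8 := mbp_mem_F h3 h4 h6
    have h9 := hmax _ h8
    obtain ⟨s, f⟩ := o
    obtain ⟨-, -, h11, h12⟩ := ho
    simp only at h5 h7 h9 h11 h12
    have h10 : f.arms = armsFrom T i j := by
      refine eq_of_flatten_length_le (armsFrom_ne_nil i j) h7 ?_
      rw [length_eq, length_eq, h5] at h9
      change _ + 2 * (armsFrom T i j).flatten.length ≤ _ + 2 * f.arms.flatten.length at h9
      simp only [mbp] at h9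
      omega
    have h13 : f.armLength = (armLengths T i j).sum := by
      rw [armLength, h10, List.length_flatten, map_length_armsFrom]
    rw [mbp, Prod.mk.injEq]
    refine ⟨by omega, ?_⟩
    cases f
    simp_all
  · rintro ⟨i, j, h1, h2, h3, h4, h5, rfl⟩
    refine ⟨i, j, by omega, by omega, mbp_mem_F h1 h2 h5, fun o' ho' => ?_⟩
    obtain ⟨-, -, h6, -, C, hC⟩ := mem_F ho'
    rw [length_eq, length_eq, h6, mbp, armLength, armLength]
    simp only
    rw [← hC, List.flatten_append, List.length_append]
    omega

theorem mbp_injective {i' j' : ℕ} (hij : i ≤ j) (hj : j ≤ T.length) (hij' : i' ≤ j')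
    (hj' : j' ≤ T.length) (h : mbp T i j = mbp T i' j') : i = i' ∧ j = j' := by
  have h1 := congrArg (fun o => o.1 + o.2.armLength) h
  have h2 := congrArg (fun o => o.2.center.length) h
  have := sum_armLengths_le (T := T) i j
  have := sum_armLengths_le (T := T) i' j'
  simp only [armLength_mbp] at h1
  simp only [mbp, List.length_take, List.length_drop] at h1 h2
  omega

/-! ### Boundaries of the blocks in output order -/

/-- The left boundaries of the arms of lengths `ls` around a center that begins at `i`, from the
inside outwards. -/
def leftEnds : ℕ → List ℕ → List ℕ
  | _, [] => []
  | i, l :: ls => (i - l) :: leftEnds (i - l) ls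

theorem length_leftEnds (i : ℕ) (ls : List ℕ) : (leftEnds i ls).length = ls.length := by
  induction ls generalizing i with
  | nil => rfl
  | cons l ls ih => simp [leftEnds, ih]

theorem foldl_reverse_sub_sum {i : ℕ} {ls : List ℕ} (h : ls.sum ≤ i) :
    List.foldl (fun x1 x2 => x1 + x2) (i - ls.sum) ls.reverse = i := by
  have h := List.foldl_assoc (op := (· + · : ℕ → ℕ → ℕ)) (l := ls.reverse)
    (a₁ := i - ls.sum) (a₂ := 0)
  rw [Nat.add_zero, ← List.sum_eq_foldl, List.sum_reverse] at h
  rw [h]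
  omega

theorem scanl_reverse {i : ℕ} {ls : List ℕ} (h : ls.sum ≤ i) :
    List.scanl (· + ·) (i - ls.sum) ls.reverse = (leftEnds i ls).reverse ++ [i] := by
  induction ls generalizing i with
  | nil => simp [leftEnds]
  | cons l ls ih =>
    rw [List.sum_cons] at h
    rw [List.reverse_cons, List.scanl_append, List.sum_cons, ← Nat.sub_sub, ih (by omega)]
    simp only [leftEnds, List.reverse_cons, List.scanl_cons, List.scanl_nil, List.tail_cons,
      List.append_assoc, List.append_cancel_left_eq]
    rw [foldl_reverse_sub_sum (by omega), Nat.sub_add_cancel (by omega)]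

/-- Corresponding arms have equal lengths, so right boundaries mirror left ones, and only the latter
have to be stored. -/
theorem scanl_eq_cons_map_leftEnds {i j : ℕ} {ls : List ℕ} (h : ls.sum ≤ i) :
    List.scanl (· + ·) j ls = j :: (leftEnds i ls).map (fun x => i + j - x) := by
  induction ls generalizing i j with
  | nil => simp [leftEnds]
  | cons l ls ih =>
    rw [List.sum_cons] at h
    rw [List.scanl_cons, ih (i := i - l) (by omega)]
    simp only [leftEnds, List.map_cons]
    rw [show i - l + (j + l) = i + j by omega, show i + j - (i - l) = j + l by omega]

theorem encode_mbp (hij : i ≤ j) (hj : j ≤ T.length) :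
    encode (mbp T i j) = (2 * (armLengths T i j).length + min 1 (j - i)) ::
      ((leftEnds i (armLengths T i j)).reverse ++ i :: (if i = j then [] else [j]) ++
        (leftEnds i (armLengths T i j)).map (fun x => i + j - x)) := by
  have hsum := sum_armLengths_le (T := T) i j
  have hc : ((T.drop i).take (j - i)).length = j - i := by simp; omega
  have hfold := foldl_reverse_sub_sum hsum
  rw [encode, size_eq, nonemptyBlocks_eq]
  congr 1
  · rw [mbp]
    simp only [hc]
    rw [← map_length_armsFrom, List.length_map]
  · simp only [mbp, List.map_append, List.map_reverse, map_length_armsFrom]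
    rcases hij.eq_or_lt with rfl | hlt
    · simp [List.scanl_append, scanl_reverse hsum, scanl_eq_cons_map_leftEnds hsum, hfold]
    · have hne : ((T.drop i).take (j - i)).isEmpty = false := by
        rw [List.isEmpty_eq_false_iff, ne_eq, ← List.length_eq_zero_iff]
        omega
      simp [List.scanl_append, scanl_reverse hsum, scanl_eq_cons_map_leftEnds hsum, hfold, hne,
        hlt.ne, hc, Nat.add_sub_of_le hij]

end BlockPal

/-! ### Extension chains and the quadratic lower bound -/

namespace BlockPal

variable {α : Type*} {T : List α} {i j : ℕ}

/-- `T[i+1 … j]` is the center of a maximal block palindrome of `T`. -/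
def IsRoot (T : List α) (i j : ℕ) : Prop :=
  i ≤ j ∧ j ≤ T.length ∧ 0 < j ∧ i < T.length ∧ shortestBorder T i (j - i) = 0

/-- The substrings `T[i+1 … j]`, `T[i'+1 … j']`, … obtained by repeated outward extension. -/
noncomputable def chain (T : List α) (i j : ℕ) : List (ℕ × ℕ) :=
  if _ : extension T i j = 0 then [(i, j)]
  else (i, j) :: chain T (i - extension T i j) (j + extension T i j)
termination_by i
decreasing_by
  have := extension_le (T := T) (i := i) (j := j)
  omega

theorem chain_of_eq_zero (h : extension T i j = 0) : chain T i j = [(i, j)] := by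
  rw [chain, dif_pos h]

theorem chain_of_eq {l : ℕ} (hl : 0 < l) (h : extension T i j = l) :
    chain T i j = (i, j) :: chain T (i - l) (j + l) := by
  rw [chain, dif_neg (by omega), h]

theorem mem_chain_self : (i, j) ∈ chain T i j := by
  rw [chain]
  split_ifs <;> simp

theorem length_chain (i j : ℕ) : (chain T i j).length = (armLengths T i j).length + 1 := by
  induction i, j using extension_induction T with
  | zero i j h => simp [chain_of_eq_zero h, armLengths_of_eq_zero h]
  | step i j l hl h ih => simp [chain_of_eq hl h, armLengths_of_eq hl h, ih]

theorem mem_chain_extension {x y l : ℕ} (hl : 0 < l) (h : extension T x y = l)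
    (hmem : (x, y) ∈ chain T i j) : (x - l, y + l) ∈ chain T i j := by
  induction i, j using extension_induction T with
  | zero i j h' =>
    rw [chain_of_eq_zero h', List.mem_singleton, Prod.mk.injEq] at hmem
    obtain ⟨rfl, rfl⟩ := hmem
    omega
  | step i j l' hl' h' ih =>
    rw [chain_of_eq hl' h', List.mem_cons] at hmem ⊢
    rcases hmem with hmem | hmem
    · rw [Prod.mk.injEq] at hmem
      obtain ⟨rfl, rfl⟩ := hmem
      obtain rfl := h.symm.trans h'
      exact Or.inr mem_chain_self
    · exact Or.inr (ih hmem)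

/-- The shortest border covers at most half of the substring, so it can be stripped from both ends,
and extending what remains restores it. Repetition ends at an unbordered, possibly empty, substring.
-/
theorem exists_isRoot_mem_chain {x y : ℕ} (hxy : x < y) (hy : y ≤ T.length) :
    ∃ i j, IsRoot T i j ∧ (x, y) ∈ chain T i j := by
  induction hn : y - x using Nat.strong_induction_on generalizing x y with
  | _ n ih =>
    subst hn
    rcases Nat.eq_zero_or_pos (shortestBorder T x (y - x)) with h | h
    · exact ⟨x, y, ⟨hxy.le, hy, by omega, by omega, h⟩, mem_chain_self⟩
    · have h2 := two_mul_shortestBorder_le (T := T) (i := x) (m := y - x)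
      generalize hs : shortestBorder T x (y - x) = s at *
      have hext : extension T (x + s) (y - s) = s := by
        rw [extension_eq_iff h (by omega) (by omega) (by omega), Nat.add_sub_cancel,
          show y - s - (x + s) + 2 * s = y - x by omega, hs]
      obtain ⟨i, j, hr, hmem⟩ : ∃ i j, IsRoot T i j ∧ (x + s, y - s) ∈ chain T i j := by
        rcases (show x + s ≤ y - s by omega).eq_or_lt with heq | hlt
        · refine ⟨_, _, ⟨heq.le, by omega, by omega, by omega, ?_⟩, mem_chain_self⟩
          rw [heq, Nat.sub_self, shortestBorder_eq_zero]
          exact fun l _ hl => absurd hl.1 (by omega)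
        · exact ih _ (by omega) hlt (by omega) rfl
      refine ⟨i, j, hr, ?_⟩
      have := mem_chain_extension h hext hmem
      rwa [Nat.add_sub_cancel, Nat.sub_add_cancel (by omega)] at this

theorem size_mbp (hj : j ≤ T.length) :
    (mbp T i j).2.size = 2 * (armLengths T i j).length + min 1 (j - i) := by
  have hc : ((T.drop i).take (j - i)).length = j - i := by simp; omega
  rw [size_eq, mbp]
  simp only [hc]
  rw [← map_length_armsFrom, List.length_map]

theorem nodup_map_mbp {L : List (ℕ × ℕ)} (hnd : L.Nodup)
    (hL : ∀ p, p ∈ L ↔ IsRoot T p.1 p.2) : (L.map fun p => mbp T p.1 p.2).Nodup := by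
  refine List.Nodup.map_on (fun p hp q hq h => ?_) hnd
  have hp := (hL p).1 hp
  have hq := (hL q).1 hq
  exact Prod.ext_iff.2 (mbp_injective hp.1 hp.2.1 hq.1 hq.2.1 h)

theorem mem_map_mbp {L : List (ℕ × ℕ)} (hL : ∀ p, p ∈ L ↔ IsRoot T p.1 p.2)
    (o : ℕ × BlockPal α) : o ∈ (L.map fun p => mbp T p.1 p.2) ↔ o ∈ MBP T := by
  rw [mem_MBP_iff, List.mem_map]
  constructor
  · rintro ⟨p, hp, rfl⟩
    obtain ⟨h1, h2, h3, h4, h5⟩ := (hL p).1 hp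
    exact ⟨p.1, p.2, h1, h2, h3, h4, h5, rfl⟩
  · rintro ⟨i, j, h1, h2, h3, h4, h5, rfl⟩
    exact ⟨(i, j), (hL (i, j)).2 ⟨h1, h2, h3, h4, h5⟩, rfl⟩

theorem totalSize_eq_sum {L : List (ℕ × ℕ)} (hnd : L.Nodup)
    (hL : ∀ p, p ∈ L ↔ IsRoot T p.1 p.2) : totalSize T = (L.map fun p => (mbp T p.1 p.2).2.size).sum := by
  classical
  have h : MBP T = ((L.map fun p => mbp T p.1 p.2).toFinset : Set (ℕ × BlockPal α)) := by
    ext o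
    rw [← mem_map_mbp hL o, Finset.mem_coe, List.mem_toFinset]
  rw [totalSize, h, finsum_mem_coe_finset, List.sum_toFinset _ (nodup_map_mbp hnd hL),
    List.map_map]
  rfl

/-- Only empty centers can have size `0`, and each of them is determined by its position. -/
theorem length_le_totalSize_add {L : List (ℕ × ℕ)} (hnd : L.Nodup)
    (hL : ∀ p, p ∈ L ↔ IsRoot T p.1 p.2) : L.length ≤ totalSize T + T.length := by
  have h1 : (L.map fun p => 1).sum ≤
      (L.map fun p => (mbp T p.1 p.2).2.size + if p.1 = p.2 then 1 else 0).sum := by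
    refine List.sum_le_sum fun p hp => ?_
    have hp := (hL p).1 hp
    rw [size_mbp hp.2.1]
    have := hp.1
    split_ifs <;> omega
  have h2 : (L.map fun p => if p.1 = p.2 then 1 else 0).sum ≤ T.length := by
    rw [← List.sum_toFinset _ hnd, ← Finset.card_filter]
    refine (Finset.card_le_card_of_injOn Prod.fst (t := Finset.range T.length) ?_ ?_).trans
      (Finset.card_range _).le
    · intro p hp
      have hp := (hL p).1 (List.mem_toFinset.1 (Finset.mem_filter.1 hp).1)
      exact Finset.mem_coe.2 (Finset.mem_range.2 hp.2.2.2.1)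
    · intro p hp q hq h
      have hp := (Finset.mem_filter.1 hp).2
      have hq := (Finset.mem_filter.1 hq).2
      exact Prod.ext h (by omega)
  rw [List.sum_map_add, ← totalSize_eq_sum hnd hL] at h1
  simp only [List.map_const', List.sum_replicate, smul_eq_mul, mul_one] at h1
  omega

theorem two_mul_sum_range_sub (n : ℕ) : 2 * ∑ x ∈ Finset.range n, (n - x) = n * (n + 1) := by
  induction n with
  | zero => rfl
  | succ n ih =>
    rw [Finset.sum_range_succ']
    simp only [Nat.add_sub_add_right, Nat.sub_zero, mul_add, ih]
    ring

/-- Every non-empty substring of `T` lies in the chain of a root, so that the sizes of the maximal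
block palindromes add up to at least a quadratic number. -/
theorem mul_succ_le_totalSize {L : List (ℕ × ℕ)} (hnd : L.Nodup)
    (hL : ∀ p, p ∈ L ↔ IsRoot T p.1 p.2) : T.length * (T.length + 1) ≤ 4 * totalSize T + 2 * T.length := by
  have h1 : ((Finset.range T.length).sigma fun x => Finset.range (T.length - x)).card ≤
      (L.toFinset.biUnion fun p => (chain T p.1 p.2).toFinset).card := by
    -- The pair `(x, d)` stands for the non-empty substring `T[x+1 … x+d+1]`.
    refine Finset.card_le_card_of_injOn (fun s => (s.1, s.1 + s.2 + 1)) ?_ ?_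
    · rintro ⟨x, d⟩ h
      simp only [Finset.coe_sigma, Set.mem_sigma_iff, Finset.mem_coe, Finset.mem_range] at h
      obtain ⟨i, j, hr, hmem⟩ := exists_isRoot_mem_chain (T := T) (x := x) (y := x + d + 1)
        (by omega) (by omega)
      simp only [Finset.mem_coe, Finset.mem_biUnion, List.mem_toFinset]
      exact ⟨(i, j), (hL (i, j)).2 hr, hmem⟩
    · rintro ⟨x, d⟩ - ⟨x', d'⟩ - h
      simp only [Prod.mk.injEq] at h
      obtain ⟨rfl, h⟩ := h
      simp only [Sigma.mk.injEq, heq_eq_eq, true_and]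
      omega
  have h2 : ∑ p ∈ L.toFinset, (chain T p.1 p.2).toFinset.card ≤
      ∑ p ∈ L.toFinset, ((mbp T p.1 p.2).2.size + 1) := by
    refine Finset.sum_le_sum fun p hp => (List.toFinset_card_le _).trans ?_
    have hp := (hL p).1 (List.mem_toFinset.1 hp)
    rw [length_chain, size_mbp hp.2.1]
    omega
  have h3 := h1.trans (Finset.card_biUnion_le.trans h2)
  rw [Finset.card_sigma] at h3
  simp only [Finset.card_range] at h3
  rw [List.sum_toFinset _ hnd, List.sum_map_add, ← totalSize_eq_sum hnd hL] at h3
  simp only [List.map_const', List.sum_replicate, smul_eq_mul, mul_one] at h3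
  have h4 := two_mul_sum_range_sub T.length
  have h5 := length_le_totalSize_add hnd hL
  omega

end BlockPal

/-! ### Rules for single instructions -/

namespace WordRAM

/-- Started in configuration `s`, the machine reaches within `t` steps a configuration that
satisfies `Q`. -/
def Reaches (w : ℕ) (P : Program) (t : ℕ) (Q : State → Prop) (s : State) : Prop :=
  ∃ k ≤ t, Q ((step w P)^[k] s)

/-- The register file with contents `l`, all further registers being `0`. -/
def regs (l : List ℕ) (n : ℕ) : ℕ := l.getD n 0

variable {w : ℕ} {P : Program} {t t' : ℕ} {Q R : State → Prop} {s : State}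

theorem Reaches.done (h : Q s) : Reaches w P t Q s := ⟨0, Nat.zero_le _, h⟩

theorem Reaches.head (h : Reaches w P t Q (step w P s)) : Reaches w P (t + 1) Q s := by
  obtain ⟨k, hk, h⟩ := h
  exact ⟨k + 1, by omega, h⟩

theorem Reaches.trans (h : Reaches w P t Q s) (h' : ∀ s', Q s' → Reaches w P t' R s') :
    Reaches w P (t + t') R s := by
  obtain ⟨k, hk, h⟩ := h
  obtain ⟨k', hk', h'⟩ := h' _ h
  exact ⟨k' + k, by omega, by rwa [Function.iterate_add_apply]⟩

theorem Reaches.mono (h : Reaches w P t Q s) (ht : t ≤ t') : Reaches w P t' Q s := by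
  obtain ⟨k, hk, h⟩ := h
  exact ⟨k, hk.trans ht, h⟩

/-- As a literal list, the register file evaluates definitionally, so the runs below can be followed
by `rfl` and `show`. -/
theorem update_regs {l : List ℕ} {d : ℕ} (hd : d < l.length) (v : ℕ) :
    Function.update (regs l) d v = regs (l.set d v) := by
  funext n
  rcases eq_or_ne n d with rfl | h
  · simp [regs, hd]
  · simp [regs, h, List.getElem?_set_ne h.symm]

variable {pc : ℕ} {l : List ℕ} {mem : ℕ → ℕ} {y : List ℕ} {d a b v : ℕ}

theorem Reaches.const (hP : P[pc]? = some (.const d v)) (hd : d < l.length) (hv : v < 2 ^ w)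
    (h : Reaches w P t Q ⟨pc + 1, regs (l.set d v), mem, y⟩) :
    Reaches w P (t + 1) Q ⟨pc, regs l, mem, y⟩ := by
  refine Reaches.head ?_
  simpa only [step, hP, State.setReg, update_regs hd, Nat.mod_eq_of_lt hv] using h

theorem Reaches.copy (hP : P[pc]? = some (.copy d a)) (hd : d < l.length) (hv : regs l a < 2 ^ w)
    (h : Reaches w P t Q ⟨pc + 1, regs (l.set d (regs l a)), mem, y⟩) :
    Reaches w P (t + 1) Q ⟨pc, regs l, mem, y⟩ := by
  refine Reaches.head ?_
  simpa only [step, hP, State.setReg, update_regs hd, Nat.mod_eq_of_lt hv] using h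

theorem Reaches.add (hP : P[pc]? = some (.add d a b)) (hd : d < l.length)
    (hv : regs l a + regs l b < 2 ^ w)
    (h : Reaches w P t Q ⟨pc + 1, regs (l.set d (regs l a + regs l b)), mem, y⟩) :
    Reaches w P (t + 1) Q ⟨pc, regs l, mem, y⟩ := by
  refine Reaches.head ?_
  simpa only [step, hP, State.setReg, update_regs hd, Nat.mod_eq_of_lt hv] using h

theorem Reaches.mul (hP : P[pc]? = some (.mul d a b)) (hd : d < l.length)
    (hv : regs l a * regs l b < 2 ^ w)
    (h : Reaches w P t Q ⟨pc + 1, regs (l.set d (regs l a * regs l b)), mem, y⟩) :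
    Reaches w P (t + 1) Q ⟨pc, regs l, mem, y⟩ := by
  refine Reaches.head ?_
  simpa only [step, hP, State.setReg, update_regs hd, Nat.mod_eq_of_lt hv] using h

/-- Without a borrow, subtraction modulo `2 ^ w` is the truncated one. -/
theorem Reaches.sub (hP : P[pc]? = some (.sub d a b)) (hd : d < l.length)
    (hle : regs l b ≤ regs l a) (hv : regs l a < 2 ^ w)
    (h : Reaches w P t Q ⟨pc + 1, regs (l.set d (regs l a - regs l b)), mem, y⟩) :
    Reaches w P (t + 1) Q ⟨pc, regs l, mem, y⟩ := by
  refine Reaches.head ?_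
  have : (regs l a + (2 ^ w - regs l b)) % 2 ^ w = regs l a - regs l b := by
    rw [show regs l a + (2 ^ w - regs l b) = regs l a - regs l b + 2 ^ w by omega,
      Nat.add_mod_right, Nat.mod_eq_of_lt (by omega)]
  simpa only [step, hP, State.setReg, update_regs hd, this] using h

theorem Reaches.load (hP : P[pc]? = some (.load d a)) (hd : d < l.length)
    (hm : mem (regs l a) = v) (hv : v < 2 ^ w)
    (h : Reaches w P t Q ⟨pc + 1, regs (l.set d v), mem, y⟩) :
    Reaches w P (t + 1) Q ⟨pc, regs l, mem, y⟩ := by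
  subst hm
  refine Reaches.head ?_
  simpa only [step, hP, State.setReg, update_regs hd, Nat.mod_eq_of_lt hv] using h

theorem Reaches.store (hP : P[pc]? = some (.store a b))
    (h : Reaches w P t Q ⟨pc + 1, regs l, Function.update mem (regs l a) (regs l b), y⟩) :
    Reaches w P (t + 1) Q ⟨pc, regs l, mem, y⟩ := by
  refine Reaches.head ?_
  simpa only [step, hP] using h

theorem Reaches.jump (hP : P[pc]? = some (.jump v)) (h : Reaches w P t Q ⟨v, regs l, mem, y⟩) :
    Reaches w P (t + 1) Q ⟨pc, regs l, mem, y⟩ := by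
  refine Reaches.head ?_
  simpa only [step, hP] using h

theorem Reaches.jumpEq (hP : P[pc]? = some (.jumpEq a b v)) (hab : regs l a = regs l b)
    (h : Reaches w P t Q ⟨v, regs l, mem, y⟩) : Reaches w P (t + 1) Q ⟨pc, regs l, mem, y⟩ := by
  refine Reaches.head ?_
  simpa only [step, hP, if_pos hab] using h

theorem Reaches.jumpEq_of_ne (hP : P[pc]? = some (.jumpEq a b v)) (hab : regs l a ≠ regs l b)
    (h : Reaches w P t Q ⟨pc + 1, regs l, mem, y⟩) : Reaches w P (t + 1) Q ⟨pc, regs l, mem, y⟩ := by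
  refine Reaches.head ?_
  simpa only [step, hP, if_neg hab] using h

theorem Reaches.jumpLt (hP : P[pc]? = some (.jumpLt a b v)) (hab : regs l a < regs l b)
    (h : Reaches w P t Q ⟨v, regs l, mem, y⟩) : Reaches w P (t + 1) Q ⟨pc, regs l, mem, y⟩ := by
  refine Reaches.head ?_
  simpa only [step, hP, if_pos hab] using h

theorem Reaches.jumpLt_of_not_lt (hP : P[pc]? = some (.jumpLt a b v))
    (hab : ¬ regs l a < regs l b) (h : Reaches w P t Q ⟨pc + 1, regs l, mem, y⟩) :
    Reaches w P (t + 1) Q ⟨pc, regs l, mem, y⟩ := by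
  refine Reaches.head ?_
  simpa only [step, hP, if_neg hab] using h

theorem Reaches.out (hP : P[pc]? = some (.out a))
    (h : Reaches w P t Q ⟨pc + 1, regs l, mem, y ++ [regs l a]⟩) :
    Reaches w P (t + 1) Q ⟨pc, regs l, mem, y⟩ := by
  refine Reaches.head ?_
  simpa only [step, hP] using h

end WordRAM

/-! ### The program and its output routine -/

namespace WordRAM

/-- The program. With `N` the length of the input, memory is used in rows of `N + 1` cells: row `0`
is the input, rows `1` and `2` hold the lengths of the longest and the shortest borders of the
prefixes of the current suffix `T[i+1 … N]`, row `3` is a stack, and cell `j` of row `4 + i` is for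
`extension T i j`. Register `8` holds `i`, register `9` the length of the current prefix and
register `7` the candidate border that is to be lengthened. -/
def prog : Program :=
  [.const 1 1, .load 2 0, .add 3 2 1, .add 4 3 3, .add 5 4 3, .add 6 5 3, .jump 42,
  -- from position 7 on: write out the maximal block palindrome of a center
  .add 10 8 9, .copy 11 8, .copy 12 10, .copy 13 5,
  .mul 14 11 3, .add 14 14 6, .add 14 14 12, .load 15 14, .jumpEq 15 0 21,
  .sub 11 11 15, .add 12 12 15, .store 13 11, .add 13 13 1, .jump 11,
  .sub 14 13 5, .add 14 14 14, .jumpEq 9 0 25, .add 14 14 1, .out 14, .copy 16 13,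
  .jumpEq 13 5 32, .sub 13 13 1, .load 11 13, .out 11, .jump 27,
  .out 8, .jumpEq 9 0 35, .out 10, .add 15 8 10,
  .jumpEq 13 16 42, .load 11 13, .sub 12 15 11, .out 12, .add 13 13 1, .jump 36,
  -- from position 42 on: the main loop
  .add 10 8 9, .jumpEq 10 2 79, .jumpEq 9 0 55, .add 14 8 7, .add 14 14 1, .load 14 14,
  .add 15 10 1, .load 15 15, .jumpEq 14 15 61, .jumpEq 7 0 55, .add 14 3 7, .load 7 14, .jump 42,
  -- from position 55 on: the longer prefix has no border
  .add 9 9 1, .add 14 3 9, .store 14 0, .add 14 4 9, .store 14 0, .jump 7,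
  -- from position 61 on: the longer prefix has a border
  .add 9 9 1, .add 7 7 1, .add 14 3 9, .store 14 7, .add 14 4 7, .load 15 14, .jumpLt 0 15 69,
  .copy 15 7, .add 14 4 9, .store 14 15, .add 14 8 15, .mul 14 14 3, .add 14 14 6, .add 11 8 9,
  .sub 11 11 15, .add 14 14 11, .store 14 15, .jump 42,
  -- from position 79 on: the next suffix
  .add 8 8 1, .const 9 0, .const 7 0, .jumpLt 8 2 7]

/-- The contents of the registers after the initialization. -/
abbrev frame (N b i m r₁₀ r₁₁ r₁₂ r₁₃ r₁₄ r₁₅ r₁₆ : ℕ) : List ℕ :=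
  [0, 1, N, N + 1, 2 * (N + 1), 3 * (N + 1), 4 * (N + 1), b, i, m, r₁₀, r₁₁, r₁₂, r₁₃, r₁₄, r₁₅, r₁₆]

open BlockPal

variable {w : ℕ} {T : List ℕ} {mem : ℕ → ℕ} {N b i m j : ℕ}

theorem address_lt (hw : (N + 8) ^ 2 ≤ 2 ^ w) {x y : ℕ} (hx : x ≤ N) (hy : y ≤ N) :
    x * (N + 1) + 4 * (N + 1) + y + 1 < 2 ^ w := by
  have : x * (N + 1) ≤ N * (N + 1) := Nat.mul_le_mul_right _ hx
  nlinarith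

theorem lt_two_pow (hw : (N + 8) ^ 2 ≤ 2 ^ w) : 16 * N + 64 ≤ 2 ^ w := by nlinarith

theorem leftEnds_le {x : ℕ} {ls : List ℕ} : ∀ v ∈ leftEnds x ls, v ≤ x := by
  induction ls generalizing x with
  | nil => simp [leftEnds]
  | cons l ls ih =>
    intro v hv
    rcases List.mem_cons.1 hv with rfl | hv
    · omega
    · have := ih v hv
      omega

/-- Every arm moves `x` left by at least one, so `q + x ≤ T.length` persists and keeps the stack in
row `3`, away from the table. -/
theorem reaches_walk (hw : (T.length + 8) ^ 2 ≤ 2 ^ w) {r₁₀ r₁₆ : ℕ} {out : List ℕ} (x y : ℕ)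
    (mem : ℕ → ℕ) (q r₁₄ r₁₅ : ℕ) (hxy : x ≤ y) (hy : y ≤ T.length) (hq : q + x ≤ T.length)
    (hmem : ∀ x' ≤ x, ∀ y', x' ≤ y' → y' ≤ T.length →
      mem (x' * (T.length + 1) + 4 * (T.length + 1) + y') = extension T x' y') :
    Reaches w prog (10 * (armLengths T x y).length + 5)
      (fun s => ∃ mem' r₁₁ r₁₂ r₁₄ r₁₅, s = ⟨21, regs (frame T.length b i m r₁₀ r₁₁ r₁₂
          (3 * (T.length + 1) + (q + (armLengths T x y).length)) r₁₄ r₁₅ r₁₆), mem', out⟩ ∧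
        (∀ t v, (leftEnds x (armLengths T x y))[t]? = some v →
          mem' (3 * (T.length + 1) + (q + t)) = v) ∧
        ∀ a, a < 3 * (T.length + 1) + q ∨ 4 * (T.length + 1) ≤ a → mem' a = mem a)
      ⟨11, regs (frame T.length b i m r₁₀ x y (3 * (T.length + 1) + q) r₁₄ r₁₅ r₁₆), mem, out⟩ := by
  induction x, y using extension_induction T generalizing mem q r₁₄ r₁₅ with
  | zero x y h =>
    have h1 := address_lt hw (x := x) (y := y) (by omega) hy
    have h2 := hmem x le_rfl y hxy hy
    refine Reaches.mul rfl (Nat.le_of_ble_eq_true rfl) ?_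
      (Reaches.add rfl (Nat.le_of_ble_eq_true rfl) ?_
      (Reaches.add rfl (Nat.le_of_ble_eq_true rfl) ?_
      (Reaches.load rfl (Nat.le_of_ble_eq_true rfl) h2 ?_
      (Reaches.jumpEq rfl h (Reaches.done ?_)))))
    · change x * (T.length + 1) < _
      omega
    · change x * (T.length + 1) + 4 * (T.length + 1) < _
      omega
    · change x * (T.length + 1) + 4 * (T.length + 1) + y < _
      omega
    · omega
    · rw [armLengths_of_eq_zero h]
      exact ⟨mem, _, _, _, _, rfl, by simp [leftEnds], fun _ _ => rfl⟩
  | step x y l hl h ih =>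
    have h1 := address_lt hw (x := x) (y := y) (by omega) hy
    have h2 := hmem x le_rfl y hxy hy
    have h3 := ((extension_eq hl).1 h).1
    have h4 := lt_two_pow hw
    rw [h] at h2
    rw [armLengths_of_eq hl h]
    refine Reaches.mono (t := (10 * (armLengths T (x - l) (y + l)).length + 5) + 10) ?_
      (by rw [List.length_cons]; omega)
    refine Reaches.mul rfl (Nat.le_of_ble_eq_true rfl) ?_
      (Reaches.add rfl (Nat.le_of_ble_eq_true rfl) ?_
      (Reaches.add rfl (Nat.le_of_ble_eq_true rfl) ?_
      (Reaches.load rfl (Nat.le_of_ble_eq_true rfl) h2 ?_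
      (Reaches.jumpEq_of_ne rfl hl.ne'
      (Reaches.sub rfl (Nat.le_of_ble_eq_true rfl) h3.1 ?_
      (Reaches.add rfl (Nat.le_of_ble_eq_true rfl) ?_
      (Reaches.store rfl
      (Reaches.add rfl (Nat.le_of_ble_eq_true rfl) ?_
      (Reaches.jump rfl ?_)))))))))
    · change x * (T.length + 1) < _
      omega
    · change x * (T.length + 1) + 4 * (T.length + 1) < _
      omega
    · change x * (T.length + 1) + 4 * (T.length + 1) + y < _
      omega
    · omega
    · change x < _
      omega
    · change y + l < _
      omega
    · change 3 * (T.length + 1) + q + 1 < _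
      omega
    · have := ih (Function.update mem (3 * (T.length + 1) + q) (x - l)) (q + 1)
        (x * (T.length + 1) + 4 * (T.length + 1) + y) l (by omega) (by omega) (by omega) (by
          intro x' hx' y' h5 h6
          rw [Function.update_of_ne (by omega)]
          exact hmem x' (by omega) y' h5 h6)
      obtain ⟨k, hk, mem', r₁₁, r₁₂, r₁₄, r₁₅, h5, h6, h7⟩ := this
      refine ⟨k, hk, mem', r₁₁, r₁₂, r₁₄, r₁₅, ?_, ?_, ?_⟩
      · rw [List.length_cons, show q + ((armLengths T (x - l) (y + l)).length + 1) =
          q + 1 + (armLengths T (x - l) (y + l)).length by omega]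
        exact h5
      · intro t v ht
        rcases t with _ | t
        · simp only [leftEnds, List.getElem?_cons_zero, Option.some.injEq] at ht
          rw [h7 _ (by omega)]
          exact (Function.update_self _ _ _).trans ht
        · rw [← h6 t v (by simpa [leftEnds] using ht)]
          congr 2
          omega
      · intro a ha
        rw [h7 a (by omega), Function.update_of_ne (by omega)]

/-- The innermost left end is at the bottom of the stack, so popping gives the left boundaries in
increasing order. -/
theorem reaches_pop (hw : (N + 8) ^ 2 ≤ 2 ^ w) {r₁₀ r₁₂ r₁₄ r₁₅ r₁₆ : ℕ} {lf : List ℕ}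
    (hlf : lf.length ≤ N) (hle : ∀ v ∈ lf, v ≤ N)
    (hst : ∀ t v, lf[t]? = some v → mem (3 * (N + 1) + t) = v) (q r₁₁ : ℕ) (hq : q ≤ lf.length)
    (out : List ℕ) :
    Reaches w prog (5 * q + 1)
      (fun s => ∃ r₁₁, s = ⟨32, regs (frame N b i m r₁₀ r₁₁ r₁₂ (3 * (N + 1)) r₁₄ r₁₅ r₁₆), mem,
        out ++ (lf.take q).reverse⟩)
      ⟨27, regs (frame N b i m r₁₀ r₁₁ r₁₂ (3 * (N + 1) + q) r₁₄ r₁₅ r₁₆), mem, out⟩ := by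
  have h4 := lt_two_pow hw
  induction q generalizing r₁₁ out with
  | zero =>
    refine Reaches.jumpEq rfl rfl (Reaches.done ⟨r₁₁, ?_⟩)
    simp
  | succ q ih =>
    have hget : lf[q]? = some lf[q] := List.getElem?_eq_getElem (by omega)
    have hv := hle _ (List.getElem_mem (show q < lf.length by omega))
    refine Reaches.mono (t := (5 * q + 1) + 5) ?_ (by omega)
    refine Reaches.jumpEq_of_ne rfl (show 3 * (N + 1) + (q + 1) ≠ 3 * (N + 1) by omega)
      (Reaches.sub rfl (Nat.le_of_ble_eq_true rfl)
        (show 1 ≤ 3 * (N + 1) + (q + 1) by omega) (show 3 * (N + 1) + (q + 1) < _ by omega)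
      (Reaches.load (v := lf[q]) rfl (Nat.le_of_ble_eq_true rfl) (hst q _ hget) (by omega)
      (Reaches.out rfl (Reaches.jump rfl ?_))))
    obtain ⟨k, hk, r, h⟩ := ih lf[q] (by omega) (out ++ [lf[q]])
    refine ⟨k, hk, r, ?_⟩
    rw [← List.take_concat_get' lf q (by omega), List.reverse_append, ← List.append_assoc]
    exact h

/-- Popping leaves the cells in place; reading them upwards and reflecting with `S = i + j` gives
the right boundaries. -/
theorem reaches_ascend (hw : (N + 8) ^ 2 ≤ 2 ^ w) {r₁₀ r₁₄ S : ℕ} {lf : List ℕ}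
    (hlf : lf.length ≤ N) (hle : ∀ v ∈ lf, v ≤ N) (hS : S ≤ 2 * N) (hle' : ∀ v ∈ lf, v ≤ S)
    (hst : ∀ t v, lf[t]? = some v → mem (3 * (N + 1) + t) = v) (n q r₁₁ r₁₂ : ℕ)
    (hq : q + n = lf.length) (out : List ℕ) :
    Reaches w prog (6 * n + 1)
      (fun s => ∃ r₁₁ r₁₂ r₁₃, s = ⟨42, regs (frame N b i m r₁₀ r₁₁ r₁₂ r₁₃ r₁₄ S
        (3 * (N + 1) + lf.length)), mem, out ++ (lf.drop q).map (fun x => S - x)⟩)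
      ⟨36, regs (frame N b i m r₁₀ r₁₁ r₁₂ (3 * (N + 1) + q) r₁₄ S (3 * (N + 1) + lf.length)), mem,
        out⟩ := by
  have h4 := lt_two_pow hw
  induction n generalizing q r₁₁ r₁₂ out with
  | zero =>
    have hq' : 3 * (N + 1) + q = 3 * (N + 1) + lf.length := by omega
    refine Reaches.jumpEq rfl hq' (Reaches.done ⟨r₁₁, r₁₂, 3 * (N + 1) + q, ?_⟩)
    rw [List.drop_of_length_le (by omega)]
    simp only [List.map_nil, List.append_nil]
  | succ n ih =>
    have hget : lf[q]? = some lf[q] := List.getElem?_eq_getElem (by omega)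
    have hv := hle _ (List.getElem_mem (show q < lf.length by omega))
    have hv' := hle' _ (List.getElem_mem (show q < lf.length by omega))
    refine Reaches.mono (t := (6 * n + 1) + 6) ?_ (by omega)
    refine Reaches.jumpEq_of_ne rfl
      (show 3 * (N + 1) + q ≠ 3 * (N + 1) + lf.length by omega)
      (Reaches.load (v := lf[q]) rfl (Nat.le_of_ble_eq_true rfl) (hst q _ hget) (by omega)
      (Reaches.sub rfl (Nat.le_of_ble_eq_true rfl) hv' (show S < _ by omega)
      (Reaches.out rfl (Reaches.add rfl (Nat.le_of_ble_eq_true rfl)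
        (show 3 * (N + 1) + q + 1 < _ by omega) (Reaches.jump rfl ?_)))))
    obtain ⟨k, hk, r, r', r'', h⟩ := ih (q + 1) lf[q] (S - lf[q]) (by omega) (out ++ [S - lf[q]])
    refine ⟨k, hk, r, r', r'', ?_⟩
    rw [List.drop_eq_getElem_cons (by omega), List.map_cons, List.append_cons out (S - lf[q])]
    exact h

end WordRAM

namespace WordRAM

open BlockPal

variable {w : ℕ} {T : List ℕ} {mem : ℕ → ℕ} {N b i m j : ℕ}

theorem reaches_write_size (hw : (N + 8) ^ 2 ≤ 2 ^ w) {r₁₀ r₁₁ r₁₂ r₁₄ r₁₅ r₁₆ q : ℕ} (hq : q ≤ N)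
    (out : List ℕ) :
    Reaches w prog 6 (fun s => ∃ r₁₄, s = ⟨27, regs (frame N b i m r₁₀ r₁₁ r₁₂ (3 * (N + 1) + q)
        r₁₄ r₁₅ (3 * (N + 1) + q)), mem, out ++ [2 * q + min 1 m]⟩)
      ⟨21, regs (frame N b i m r₁₀ r₁₁ r₁₂ (3 * (N + 1) + q) r₁₄ r₁₅ r₁₆), mem, out⟩ := by
  have h4 := lt_two_pow hw
  have h5 : 3 * (N + 1) + q - 3 * (N + 1) + (3 * (N + 1) + q - 3 * (N + 1)) = 2 * q := by omega
  refine Reaches.sub rfl (Nat.le_of_ble_eq_true rfl)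
    (show 3 * (N + 1) ≤ 3 * (N + 1) + q by omega) (show 3 * (N + 1) + q < _ by omega)
    (Reaches.add rfl (Nat.le_of_ble_eq_true rfl) (lt_of_eq_of_lt h5 (by omega)) ?_)
  rcases Nat.eq_zero_or_pos m with rfl | hm
  · refine Reaches.jumpEq rfl rfl ?_
    refine Reaches.out rfl
      (Reaches.copy rfl (Nat.le_of_ble_eq_true rfl) (show 3 * (N + 1) + q < _ by omega)
      ?_)
    refine Reaches.done ⟨2 * q, ?_⟩
    rw [show 2 * q + min 1 0 = 2 * q by omega, ← h5]
    rfl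
  · refine Reaches.jumpEq_of_ne rfl hm.ne'
      (Reaches.add rfl (Nat.le_of_ble_eq_true rfl) 
      (lt_of_eq_of_lt (congrArg (· + 1) h5) (show 2 * q + 1 < _ by omega))
      (Reaches.out rfl (Reaches.copy rfl (Nat.le_of_ble_eq_true rfl)
      (show 3 * (N + 1) + q < _ by omega) (Reaches.done ⟨2 * q + 1, ?_⟩))))
    rw [show 2 * q + min 1 m = 2 * q + 1 by omega, ← h5]
    rfl

theorem reaches_write_center (hw : (N + 8) ^ 2 ≤ 2 ^ w) {r₁₁ r₁₂ r₁₃ r₁₄ r₁₅ r₁₆ : ℕ}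
    (him : i + m ≤ N) (out : List ℕ) :
    Reaches w prog 4 (fun s => s = ⟨36, regs (frame N b i m (i + m) r₁₁ r₁₂ r₁₃ r₁₄
        (i + (i + m)) r₁₆), mem, out ++ (i :: if i = i + m then [] else [i + m])⟩)
      ⟨32, regs (frame N b i m (i + m) r₁₁ r₁₂ r₁₃ r₁₄ r₁₅ r₁₆), mem, out⟩ := by
  have h4 := lt_two_pow hw
  refine Reaches.out rfl ?_
  rcases Nat.eq_zero_or_pos m with rfl | hm
  · refine Reaches.jumpEq rfl rfl (Reaches.add rfl (Nat.le_of_ble_eq_true rfl)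
      (show i + (i + 0) < _ by omega) (Reaches.done ?_))
    simp only [Nat.add_zero, if_true]
    rfl
  · refine Reaches.jumpEq_of_ne rfl hm.ne' (Reaches.out rfl
      (Reaches.add rfl (Nat.le_of_ble_eq_true rfl) (show i + (i + m) < _ by omega)
      (Reaches.done ?_)))
    rw [if_neg (show i ≠ i + m by omega), List.append_cons out i]
    rfl

/-- The program writes out the maximal block palindrome with center `T[i+1 … i+m]`, provided that
the table of extensions is complete up to row `i`. -/
theorem reaches_write (hw : (T.length + 8) ^ 2 ≤ 2 ^ w) (him : i + m ≤ T.length)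
    (hmem : ∀ x ≤ i, ∀ y, x ≤ y → y ≤ T.length →
      mem (x * (T.length + 1) + 4 * (T.length + 1) + y) = extension T x y)
    (r₁₀ r₁₁ r₁₂ r₁₃ r₁₄ r₁₅ r₁₆ : ℕ) (out : List ℕ) :
    Reaches w prog (21 * (mbp T i (i + m)).2.size + 21)
      (fun s => ∃ mem' r₁₀ r₁₁ r₁₂ r₁₃ r₁₄ r₁₅ r₁₆, s = ⟨42, regs (frame T.length b i m
          r₁₀ r₁₁ r₁₂ r₁₃ r₁₄ r₁₅ r₁₆), mem', out ++ encode (mbp T i (i + m))⟩ ∧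
        ∀ a, a < 3 * (T.length + 1) ∨ 4 * (T.length + 1) ≤ a → mem' a = mem a)
      ⟨7, regs (frame T.length b i m r₁₀ r₁₁ r₁₂ r₁₃ r₁₄ r₁₅ r₁₆), mem, out⟩ := by
  have h4 := lt_two_pow hw
  have hn := length_armLengths_le (T := T) i (i + m)
  have hlen := length_leftEnds i (armLengths T i (i + m))
  have hle := leftEnds_le (x := i) (ls := armLengths T i (i + m))
  -- The phases add up to 21 steps per arm and 21 more, and there are at most as many arms as
  -- blocks.
  refine Reaches.mono (t := 10 * (armLengths T i (i + m)).length + 5 +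
    (6 + (5 * (armLengths T i (i + m)).length + 1 +
      (4 + (6 * (armLengths T i (i + m)).length + 1)))) + 4) ?_
    (by rw [size_mbp him]; omega)
  refine Reaches.add rfl (Nat.le_of_ble_eq_true rfl) (show i + m < _ by omega)
    (Reaches.copy rfl (Nat.le_of_ble_eq_true rfl) (show i < _ by omega)
    (Reaches.copy rfl (Nat.le_of_ble_eq_true rfl) (show i + m < _ by omega)
    (Reaches.copy rfl (Nat.le_of_ble_eq_true rfl) (show 3 * (T.length + 1) < _ by omega)
    ((reaches_walk hw i (i + m) mem 0 r₁₄ r₁₅ (by omega) him (by omega) hmem).trans ?_))))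
  rintro _ ⟨mem', s₁₁, s₁₂, s₁₄, s₁₅, rfl, hst, hmem'⟩
  simp only [Nat.zero_add] at hst ⊢
  refine (reaches_write_size hw (by omega) out).trans ?_
  rintro _ ⟨t₁₄, rfl⟩
  rw [← hlen]
  refine (reaches_pop hw (by omega) (fun v hv => (hle v hv).trans (by omega)) hst _ _ le_rfl
    _).trans ?_
  rintro _ ⟨u₁₁, rfl⟩
  refine (reaches_write_center hw him _).trans ?_
  rintro _ rfl
  obtain ⟨k, hk, v₁₁, v₁₂, v₁₃, h⟩ := reaches_ascend (b := b) (i := i) (m := m) (r₁₀ := i + m)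
    (r₁₄ := t₁₄) (S := i + (i + m)) hw (by omega) (fun v hv => (hle v hv).trans (by omega))
    (by omega) (fun v hv => (hle v hv).trans (by omega)) hst _ 0 u₁₁ s₁₂ (Nat.zero_add _) _
  refine ⟨k, hk, mem', i + m, v₁₁, v₁₂, v₁₃, t₁₄, i + (i + m),
    3 * (T.length + 1) + (leftEnds i (armLengths T i (i + m))).length, h.trans ?_,
    fun a ha => hmem' a (by omega)⟩
  rw [encode_mbp (by omega) him, List.take_length, List.drop_zero, hlen]
  simp

end WordRAM

/-! ### Invariants of the memory and of the main loop -/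

namespace WordRAM

open BlockPal

variable {w : ℕ} {T : List ℕ} {mem : ℕ → ℕ} {i m b : ℕ}

/-- The contents of the memory after the prefixes of `T[i+1 … N]` of length at most `m` have been
dealt with. -/
structure MemInv (T : List ℕ) (i m : ℕ) (mem : ℕ → ℕ) : Prop where
  input : ∀ p < T.length, mem (p + 1) = T.getD p 0
  longest : ∀ t, 0 < t → t ≤ m → IsGreatest {l | IsBorder T i t l} (mem (T.length + 1 + t))
  shortest : ∀ t, 0 < t → t ≤ m → mem (2 * (T.length + 1) + t) = shortestBorder T i t
  -- The value `0` means both "not yet found" and "no extension", so the table needs no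
  -- initialization.
  sound : ∀ x y, x ≤ y → y ≤ T.length →
    mem (x * (T.length + 1) + 4 * (T.length + 1) + y) = 0 ∨
      mem (x * (T.length + 1) + 4 * (T.length + 1) + y) = extension T x y
  -- An extension is known once the substring it leads to has been treated, in lexicographic order
  -- of start and length.
  complete : ∀ x y, x ≤ y → y ≤ T.length → x - extension T x y < i ∨
    x - extension T x y = i ∧ y + extension T x y ≤ i + m →
      mem (x * (T.length + 1) + 4 * (T.length + 1) + y) = extension T x y

theorem mul_add_injective {n x y x' y' : ℕ} (hy : y ≤ n) (hy' : y' ≤ n)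
    (h : x * (n + 1) + y = x' * (n + 1) + y') : x = x' ∧ y = y' := by
  have hx : x = x' := by
    have := congrArg (· / (n + 1)) h
    simpa [Nat.mul_comm _ (n + 1), Nat.mul_add_div, Nat.div_eq_of_lt (Nat.lt_succ_of_le hy),
      Nat.div_eq_of_lt (Nat.lt_succ_of_le hy')] using this
  subst hx
  exact ⟨rfl, by omega⟩

theorem shortestBorder_eq_extension {x y : ℕ} (hxy : x ≤ y) (hy : y ≤ T.length)
    (h0 : 0 < extension T x y) (hi : x - extension T x y = i)
    (hm : y + extension T x y = i + m) : shortestBorder T i m = extension T x y := by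
  have hx := extension_le (T := T) (i := x) (j := y)
  have := (extension_eq_iff h0 hx hxy (add_extension_le hy)).1 rfl
  rwa [hi, show y - x + 2 * extension T x y = m by omega] at this

/-- A non-zero extension leads to a start left of `i`, hence into a finished suffix; for a zero one,
soundness suffices. -/
theorem MemInv.table (h : MemInv T i m mem) (x : ℕ) (hx : x ≤ i) (y : ℕ) (hxy : x ≤ y)
    (hy : y ≤ T.length) :
    mem (x * (T.length + 1) + 4 * (T.length + 1) + y) = extension T x y := by
  have h1 := h.sound x y hxy hy
  have h2 := h.complete x y hxy hy
  have h3 := extension_le (T := T) (i := x) (j := y)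
  by_cases h4 : x - extension T x y < i
  · exact h2 (Or.inl h4)
  · omega

theorem memInv_init (T : List ℕ) : MemInv T 0 0 (init T).mem := by
  have h0 : ∀ x y, (init T).mem (x * (T.length + 1) + 4 * (T.length + 1) + y) = 0 := fun x y => by
    rw [init]
    simp only
    rw [if_neg (by omega)]
    exact List.getD_eq_default _ _ (by omega)
  refine ⟨fun p _ => ?_, fun t _ _ => by omega, fun t _ _ => by omega, fun x y _ _ => Or.inl (h0 x y),
    fun x y _ _ h => ?_⟩
  · simp [init]
  · rw [h0]
    omega

/-- The invariant ignores row `3`, the stack, and so survives the output routine. -/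
theorem MemInv.congr {mem' : ℕ → ℕ} (h : MemInv T i m mem) (hm : i + m ≤ T.length)
    (h' : ∀ a, a < 3 * (T.length + 1) ∨ 4 * (T.length + 1) ≤ a → mem' a = mem a) :
    MemInv T i m mem' := by
  refine ⟨fun p hp => ?_, fun t h0 h1 => ?_, fun t h0 h1 => ?_, fun x y hx hy => ?_,
    fun x y hx hy hd => ?_⟩
  · rw [h' _ (by omega), h.input p hp]
  · rw [h' _ (by omega)]
    exact h.longest t h0 h1
  · rw [h' _ (by omega), h.shortest t h0 h1]
  · rw [h' _ (by omega)]
    exact h.sound x y hx hy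
  · rw [h' _ (by omega), h.complete x y hx hy hd]

theorem MemInv.next (h : MemInv T i m mem) (hm : i + m = T.length) : MemInv T (i + 1) 0 mem := by
  refine ⟨h.input, fun t _ _ => by omega, fun t _ _ => by omega, h.sound, fun x y hx hy hd => ?_⟩
  have h1 := h.sound x y hx hy
  have h2 := h.complete x y hx hy
  have h3 := add_extension_le (T := T) (i := x) hy
  rcases Nat.eq_zero_or_pos (extension T x y) with h4 | h4
  · omega
  · exact h2 (by omega)

theorem MemInv.succ_of_unbordered (h : MemInv T i m mem) (hm : i + (m + 1) ≤ T.length)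
    (hb : ∀ l, 0 < l → ¬ IsBorder T i (m + 1) l) :
    MemInv T i (m + 1) (Function.update (Function.update mem (T.length + 1 + (m + 1)) 0)
      (2 * (T.length + 1) + (m + 1)) 0) := by
  have hs := shortestBorder_eq_zero.2 hb
  refine ⟨fun p hp => ?_, fun t h0 h1 => ?_, fun t h0 h1 => ?_, fun x y hx hy => ?_,
    fun x y hx hy hd => ?_⟩
  · rw [Function.update_of_ne (by omega), Function.update_of_ne (by omega), h.input p hp]
  · rw [Function.update_of_ne (by omega)]
    rcases h1.eq_or_lt with rfl | h1
    · rw [Function.update_self]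
      refine ⟨isBorder_zero h0, fun l hl => ?_⟩
      by_contra! hl'
      exact hb l hl' hl
    · rw [Function.update_of_ne (by omega)]
      exact h.longest t h0 (by omega)
  · rcases h1.eq_or_lt with rfl | h1
    · rw [Function.update_self, hs]
    · rw [Function.update_of_ne (by omega), Function.update_of_ne (by omega),
        h.shortest t h0 (by omega)]
  · rw [Function.update_of_ne (by omega), Function.update_of_ne (by omega)]
    exact h.sound x y hx hy
  · rw [Function.update_of_ne (by omega), Function.update_of_ne (by omega)]
    by_cases h1 : x - extension T x y < i ∨ x - extension T x y = i ∧ y + extension T x y ≤ i + m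
    · exact h.complete x y hx hy h1
    · have h2 := h.sound x y hx hy
      rcases Nat.eq_zero_or_pos (extension T x y) with h4 | h4
      · omega
      · have := shortestBorder_eq_extension (T := T) (i := i) (m := m + 1) hx hy h4 (by omega)
          (by omega)
        omega

/-- Only one extension leads to the new prefix, the one restoring its shortest border, so one new
table entry suffices. -/
theorem MemInv.succ_of_bordered (h : MemInv T i m mem) (hm : i + (m + 1) ≤ T.length)
    (hb : IsGreatest {l | IsBorder T i (m + 1) l} b) {s : ℕ} (hs : shortestBorder T i (m + 1) = s)
    (hs0 : 0 < s) :
    MemInv T i (m + 1) (Function.update (Function.update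
      (Function.update mem (T.length + 1 + (m + 1)) b) (2 * (T.length + 1) + (m + 1)) s)
      ((i + s) * (T.length + 1) + 4 * (T.length + 1) + (i + (m + 1) - s)) s) := by
  have hs2 := two_mul_shortestBorder_le (T := T) (i := i) (m := m + 1)
  rw [hs] at hs2
  have hext : extension T (i + s) (i + (m + 1) - s) = s := by
    rw [extension_eq_iff hs0 (by omega) (by omega) (by omega), Nat.add_sub_cancel,
      show i + (m + 1) - s - (i + s) + 2 * s = m + 1 by omega, hs]
  have htab : ∀ x y, y ≤ T.length →
      Function.update (Function.update
      (Function.update mem (T.length + 1 + (m + 1)) b) (2 * (T.length + 1) + (m + 1)) s)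
      ((i + s) * (T.length + 1) + 4 * (T.length + 1) + (i + (m + 1) - s)) s
      (x * (T.length + 1) + 4 * (T.length + 1) + y) =
        if x = i + s ∧ y = i + (m + 1) - s then s else
          mem (x * (T.length + 1) + 4 * (T.length + 1) + y) := by
    intro x y hy
    split_ifs with h1
    · rw [h1.1, h1.2, Function.update_self]
    · rw [Function.update_of_ne, Function.update_of_ne (by omega), Function.update_of_ne (by omega)]
      intro h2
      exact h1 (mul_add_injective (n := T.length) hy (by omega) (by omega))
  refine ⟨fun p hp => ?_, fun t h0 h1 => ?_, fun t h0 h1 => ?_, fun x y hx hy => ?_,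
    fun x y hx hy hd => ?_⟩
  · rw [Function.update_of_ne (by omega), Function.update_of_ne (by omega),
      Function.update_of_ne (by omega), h.input p hp]
  · rw [Function.update_of_ne (by omega), Function.update_of_ne (by omega)]
    rcases h1.eq_or_lt with rfl | h1
    · rwa [Function.update_self]
    · rw [Function.update_of_ne (by omega)]
      exact h.longest t h0 (by omega)
  · rw [Function.update_of_ne (by omega)]
    rcases h1.eq_or_lt with rfl | h1
    · rw [Function.update_self, hs]
    · rw [Function.update_of_ne (by omega), Function.update_of_ne (by omega),
        h.shortest t h0 (by omega)]
  · rw [htab x y hy]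
    split_ifs with h1
    · rw [h1.1, h1.2, hext]
      exact Or.inr rfl
    · exact h.sound x y hx hy
  · rw [htab x y hy]
    split_ifs with h1
    · rw [h1.1, h1.2, hext]
    · by_cases h1 : x - extension T x y < i ∨ x - extension T x y = i ∧ y + extension T x y ≤ i + m
      · exact h.complete x y hx hy h1
      · have h2 := h.sound x y hx hy
        have h3 := extension_le (T := T) (i := x) (j := y)
        rcases Nat.eq_zero_or_pos (extension T x y) with h4 | h4
        · omega
        · have := shortestBorder_eq_extension (T := T) (i := i) (m := m + 1) hx hy h4 (by omega)
            (by omega)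
          omega

/-- The invariant of the main loop. -/
structure LoopInv (T : List ℕ) (i m b : ℕ) (mem : ℕ → ℕ) : Prop extends MemInv T i m mem where
  le : i + m ≤ T.length
  zero : m = 0 → b = 0
  border : 0 < m → IsBorder T i m b
  -- All candidates longer than `b` have been ruled out.
  upper : 0 < m → ∀ c, IsBorder T i (m + 1) (c + 1) → c ≤ b

theorem LoopInv.of_isGreatest (h : MemInv T i (m + 1) mem) (hm : i + (m + 1) ≤ T.length)
    (hb : IsGreatest {l | IsBorder T i (m + 1) l} b) : LoopInv T i (m + 1) b mem :=
  ⟨h, hm, fun h0 => by omega, fun _ => hb.1, fun _ _ hc => hb.2 (isBorder_succ_succ.1 hc).1⟩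

theorem LoopInv.next (h : LoopInv T i m b mem) (hm : i + m = T.length) (hi : i < T.length) :
    LoopInv T (i + 1) 0 0 mem :=
  ⟨h.toMemInv.next hm, hi, fun _ => rfl, fun h0 => by omega, fun h0 => by omega⟩

/-- The remaining candidates are shorter than `b`, hence borders of `T[i+1 … i+b]`, and the longest
of these is stored. -/
theorem LoopInv.fallback (h : LoopInv T i m b mem) (hm : 0 < m) (hb : 0 < b)
    (hne : T[i + b]? ≠ T[i + m]?) :
    LoopInv T i m (mem (T.length + 1 + b)) mem ∧ mem (T.length + 1 + b) < b := by
  have hbm := h.border hm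
  have hg := h.longest b hb hbm.1.le
  refine ⟨⟨h.toMemInv, h.le, fun h0 => by omega, fun _ => ?_, fun _ c hc => ?_⟩, hg.1.1⟩
  · exact (hbm.trans_iff hg.1.1).2 hg.1
  · obtain ⟨h1, h2⟩ := isBorder_succ_succ.1 hc
    have h3 := (h.upper hm c hc).lt_of_ne fun h4 => hne (h4 ▸ h2)
    exact hg.2 ((hbm.trans_iff h3).1 h1)

theorem LoopInv.unbordered (h : LoopInv T i m b mem)
    (hne : m = 0 ∨ b = 0 ∧ T[i + b]? ≠ T[i + m]?) :
    ∀ l, 0 < l → ¬ IsBorder T i (m + 1) l := by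
  rintro l hl hbl
  rcases Nat.eq_zero_or_pos m with rfl | hm
  · have := hbl.1
    omega
  · obtain ⟨c, rfl⟩ : ∃ c, l = c + 1 := ⟨l - 1, by omega⟩
    obtain ⟨rfl, hne⟩ := hne.resolve_left hm.ne'
    have h1 := h.upper hm c hbl
    obtain rfl : c = 0 := by omega
    exact hne (isBorder_succ_succ.1 hbl).2

theorem LoopInv.isGreatest (h : LoopInv T i m b mem) (hm : 0 < m) (heq : T[i + b]? = T[i + m]?) :
    IsGreatest {l | IsBorder T i (m + 1) l} (b + 1) := by
  refine ⟨isBorder_succ_succ.2 ⟨h.border hm, heq⟩, fun l hl => ?_⟩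
  rcases l with _ | c
  · omega
  · have := h.upper hm c hl
    omega

theorem LoopInv.shortestBorder_succ (h : LoopInv T i m b mem) (hm : 0 < m)
    (heq : T[i + b]? = T[i + m]?) :
    shortestBorder T i (m + 1) = if mem (2 * (T.length + 1) + (b + 1)) = 0 then b + 1 else
      mem (2 * (T.length + 1) + (b + 1)) := by
  have hg := h.isGreatest hm heq
  have := (h.border hm).1
  rw [h.shortest (b + 1) (by omega) (by omega)]
  exact shortestBorder_of_longest hg.1 fun c hc => hg.2 hc

theorem getD_eq_getD_iff {p q : ℕ} (hp : p < T.length) (hq : q < T.length) :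
    T.getD p 0 = T.getD q 0 ↔ T[p]? = T[q]? := by
  simp [hp, hq]

end WordRAM

/-! ### Amortized running time of the main loop -/

namespace WordRAM

open BlockPal

variable {w : ℕ} {T : List ℕ} {mem : ℕ → ℕ} {i m b B t : ℕ} {L : List (ℕ × ℕ)} {s : State}

/-- The time that is allotted to writing out the maximal block palindromes with the centers `L`. -/
noncomputable def cost (T : List ℕ) (L : List (ℕ × ℕ)) : ℕ :=
  (L.map fun p => 21 * (mbp T p.1 p.2).2.size + 21).sum

/-- What the program has to write for the centers `L`. -/
noncomputable def written (T : List ℕ) (L : List (ℕ × ℕ)) : List ℕ :=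
  L.flatMap fun p => encode (mbp T p.1 p.2)

/-- From configuration `s`, reached after writing out the centers `L`, the program finishes its
work; apart from writing out, it needs at most `B` steps. -/
def Finishes (w : ℕ) (T : List ℕ) (L : List (ℕ × ℕ)) (B : ℕ) (s : State) : Prop :=
  ∃ k L', L'.Nodup ∧ (∀ p, p ∈ L' ↔ IsRoot T p.1 p.2) ∧ k + cost T L ≤ B + cost T L' ∧
    prog.length ≤ ((step w prog)^[k] s).pc ∧ ((step w prog)^[k] s).output = written T L'

theorem Finishes.of_reaches (h : Reaches w prog t (Finishes w T L B) s) :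
    Finishes w T L (B + t) s := by
  obtain ⟨k, hk, k', L', h1, h2, h3, h4, h5⟩ := h
  rw [← Function.iterate_add_apply] at h4 h5
  exact ⟨k' + k, L', h1, h2, by omega, h4, h5⟩

theorem Finishes.mono {B' : ℕ} (h : Finishes w T L B s) (hB : B ≤ B') : Finishes w T L B' s := by
  obtain ⟨k, L', h1, h2, h3, h4⟩ := h
  exact ⟨k, L', h1, h2, by omega, h4⟩

/-- The centers `L` are those found before the prefix of length `m` of `T[i+1 … N]`. -/
def FoundBefore (T : List ℕ) (i m : ℕ) (L : List (ℕ × ℕ)) : Prop :=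
  L.Nodup ∧ ∀ p, p ∈ L ↔ IsRoot T p.1 p.2 ∧ (p.1 < i ∨ p.1 = i ∧ p.2 < i + m)

/-- Every run that enters the main loop with registers `i`, `m`, `b` finishes within time `B`. -/
def LoopFinishes (w : ℕ) (T : List ℕ) (i m b B : ℕ) : Prop :=
  ∀ mem L, LoopInv T i m b mem → FoundBefore T i (m + 1) L → ∀ r₁₀ r₁₁ r₁₂ r₁₃ r₁₄ r₁₅ r₁₆,
    Finishes w T L B ⟨42, regs (frame T.length b i m r₁₀ r₁₁ r₁₂ r₁₃ r₁₄ r₁₅ r₁₆), mem,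
      written T L⟩

theorem FoundBefore.succ (h : FoundBefore T i m L) (hr : IsRoot T i (i + m)) :
    FoundBefore T i (m + 1) (L ++ [(i, i + m)]) := by
  refine ⟨List.Nodup.append h.1 (List.nodup_singleton _) ?_, fun p => ?_⟩
  · intro p hp hp'
    rw [List.mem_singleton] at hp'
    subst hp'
    have := ((h.2 _).1 hp).2
    simp only at this
    omega
  · rw [List.mem_append, h.2, List.mem_singleton]
    constructor
    · rintro (⟨h1, h2⟩ | rfl)
      · exact ⟨h1, by omega⟩
      · exact ⟨hr, Or.inr ⟨rfl, by simp⟩⟩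
    · rintro ⟨h1, h2⟩
      by_cases h3 : p.1 = i ∧ p.2 = i + m
      · exact Or.inr (Prod.ext h3.1 h3.2)
      · exact Or.inl ⟨h1, by omega⟩

theorem FoundBefore.succ_of_not_isRoot (h : FoundBefore T i m L) (hr : ¬ IsRoot T i (i + m)) :
    FoundBefore T i (m + 1) L := by
  refine ⟨h.1, fun p => ?_⟩
  rw [h.2]
  refine and_congr_right fun h1 => ⟨fun _ => by omega, fun h2 => ?_⟩
  by_contra h3
  rw [show i = p.1 by omega, show p.1 + m = p.2 by omega] at hr
  exact hr h1

theorem FoundBefore.next (h : FoundBefore T i (m + 1) L) (hm : i + m = T.length) :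
    FoundBefore T (i + 1) 0 L := by
  refine ⟨h.1, fun p => ?_⟩
  rw [h.2]
  refine and_congr_right fun h1 => ?_
  have := h1.1
  have := h1.2.1
  omega

/-- Writing is paid for by the `cost` of the new center, so `B` does not change. -/
theorem finishes_of_write (hw : (T.length + 8) ^ 2 ≤ 2 ^ w) (h : LoopFinishes w T i m b B)
    (hinv : LoopInv T i m b mem) (hL : FoundBefore T i m L) (hr : IsRoot T i (i + m))
    (r₁₀ r₁₁ r₁₂ r₁₃ r₁₄ r₁₅ r₁₆ : ℕ) :
    Finishes w T L B ⟨7, regs (frame T.length b i m r₁₀ r₁₁ r₁₂ r₁₃ r₁₄ r₁₅ r₁₆), mem,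
      written T L⟩ := by
  obtain ⟨k, hk, mem', s₁₀, s₁₁, s₁₂, s₁₃, s₁₄, s₁₅, s₁₆, hs, hmem'⟩ :=
    reaches_write (b := b) hw hinv.le hinv.table r₁₀ r₁₁ r₁₂ r₁₃ r₁₄ r₁₅ r₁₆ (written T L)
  obtain ⟨k', L', h1, h2, h3, h4, h5⟩ := h mem' (L ++ [(i, i + m)])
    { hinv with toMemInv := hinv.toMemInv.congr hinv.le hmem' } (hL.succ hr)
    s₁₀ s₁₁ s₁₂ s₁₃ s₁₄ s₁₅ s₁₆
  have hwr : written T (L ++ [(i, i + m)]) = written T L ++ encode (mbp T i (i + m)) := by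
    simp [written]
  have hc : cost T (L ++ [(i, i + m)]) = cost T L + (21 * (mbp T i (i + m)).2.size + 21) := by
    simp [cost]
  rw [hwr, ← hs, ← Function.iterate_add_apply] at h4 h5
  exact ⟨k' + k, L', h1, h2, by omega, h4, h5⟩

theorem finishes_next (hw : (T.length + 8) ^ 2 ≤ 2 ^ w)
    (h : i + 1 < T.length → LoopFinishes w T (i + 1) 0 0 B) (hinv : LoopInv T i m b mem)
    (hL : FoundBefore T i (m + 1) L) (hm : i + m = T.length) (r₁₀ r₁₁ r₁₂ r₁₃ r₁₄ r₁₅ r₁₆ : ℕ) :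
    Finishes w T L (B + 4) ⟨79, regs (frame T.length b i m r₁₀ r₁₁ r₁₂ r₁₃ r₁₄ r₁₅ r₁₆), mem,
      written T L⟩ := by
  have h4 := lt_two_pow hw
  refine Finishes.of_reaches (Reaches.add rfl (Nat.le_of_ble_eq_true rfl) (show i + 1 < _ by omega)
    (Reaches.const rfl (Nat.le_of_ble_eq_true rfl) (by omega)
    (Reaches.const rfl (Nat.le_of_ble_eq_true rfl) (by omega) ?_)))
  by_cases hi : i + 1 < T.length
  -- A later suffix begins with the output routine, since the empty string in front of it is a
  -- center; the first suffix does not, as `(0, 0)` is no root.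
  · refine Reaches.jumpLt rfl hi (Reaches.done ?_)
    refine finishes_of_write hw (h hi) (hinv.next hm (by omega)) (hL.next hm)
      ⟨le_rfl, hi.le, by omega, hi, ?_⟩ _ _ _ _ _ _ _
    rw [shortestBorder_eq_zero]
    exact fun l _ hl => absurd hl.1 (by omega)
  · refine Reaches.jumpLt_of_not_lt rfl hi (Reaches.done ⟨0, L, hL.1, fun p => ?_, by omega,
      le_rfl, rfl⟩)
    rw [hL.2]
    refine and_iff_left_of_imp fun hp => ?_
    have := hp.2.2.2.1
    have := hp.2.1
    omega

theorem finishes_unbordered (hw : (T.length + 8) ^ 2 ≤ 2 ^ w)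
    (h : LoopFinishes w T i (m + 1) 0 B) (hinv : LoopInv T i m 0 mem)
    (hL : FoundBefore T i (m + 1) L) (hm : i + m < T.length)
    (hne : ∀ l, 0 < l → ¬ IsBorder T i (m + 1) l) (r₁₀ r₁₁ r₁₂ r₁₃ r₁₄ r₁₅ r₁₆ : ℕ) :
    Finishes w T L (B + 6) ⟨55, regs (frame T.length 0 i m r₁₀ r₁₁ r₁₂ r₁₃ r₁₄ r₁₅ r₁₆), mem,
      written T L⟩ := by
  have h4 := lt_two_pow hw
  refine Finishes.of_reaches (Reaches.add rfl (Nat.le_of_ble_eq_true rfl) (show m + 1 < _ by omega)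
    (Reaches.add rfl (Nat.le_of_ble_eq_true rfl) (show T.length + 1 + (m + 1) < _ by omega)
    (Reaches.store rfl
    (Reaches.add rfl (Nat.le_of_ble_eq_true rfl) (show 2 * (T.length + 1) + (m + 1) < _ by omega)
    (Reaches.store rfl (Reaches.jump rfl (Reaches.done ?_)))))))
  have hs := shortestBorder_eq_zero.2 hne
  refine finishes_of_write hw h (LoopInv.of_isGreatest (hinv.toMemInv.succ_of_unbordered hm hne) hm
    ⟨isBorder_zero (by omega), fun l hl => ?_⟩) hL ⟨by omega, hm, by omega, by omega, ?_⟩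
    _ _ _ _ _ _ _
  · by_contra! hl'
    exact hne l hl' hl
  · rwa [Nat.add_sub_cancel_left]

theorem finishes_bordered (hw : (T.length + 8) ^ 2 ≤ 2 ^ w)
    (h : LoopFinishes w T i (m + 1) (b + 1) B) (hinv : LoopInv T i m b mem)
    (hL : FoundBefore T i (m + 1) L) (hm : i + m < T.length) (hm0 : 0 < m)
    (heq : T[i + b]? = T[i + m]?) (r₁₀ r₁₁ r₁₂ r₁₃ r₁₄ r₁₅ r₁₆ : ℕ) :
    Finishes w T L (B + 18) ⟨61, regs (frame T.length b i m r₁₀ r₁₁ r₁₂ r₁₃ r₁₄ r₁₅ r₁₆), mem,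
      written T L⟩ := by
  have h4 := lt_two_pow hw
  have hg := hinv.isGreatest hm0 heq
  have hbm := hg.1.1
  have hsb := hinv.shortestBorder_succ hm0 heq
  have hs2 := two_mul_shortestBorder_le (T := T) (i := i) (m := m + 1)
  set v := mem (2 * (T.length + 1) + (b + 1)) with hv
  have hvb : v ≤ b + 1 := by
    rw [hv, hinv.shortest _ (by omega) (by omega)]
    have := two_mul_shortestBorder_le (T := T) (i := i) (m := b + 1)
    omega
  have hload : Function.update mem (T.length + 1 + (m + 1)) (b + 1)
      (2 * (T.length + 1) + (b + 1)) = v := Function.update_of_ne (by omega) _ _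
  have tail : ∀ s r₁₄, shortestBorder T i (m + 1) = s → 0 < s →
      Reaches w prog 10 (Finishes w T L B) ⟨69, regs (frame T.length (b + 1) i (m + 1)
        r₁₀ r₁₁ r₁₂ r₁₃ r₁₄ s r₁₆),
        Function.update mem (T.length + 1 + (m + 1)) (b + 1), written T L⟩ := by
    intro s r₁₄ hs hs0
    rw [hs] at hs2
    have h5 := address_lt hw (x := i + s) (y := i + (m + 1) - s) (by omega) (by omega)
    refine Reaches.add rfl (Nat.le_of_ble_eq_true rfl)
      (show 2 * (T.length + 1) + (m + 1) < _ by omega) (Reaches.store rfl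
      (Reaches.add rfl (Nat.le_of_ble_eq_true rfl) (show i + s < _ by omega)
      (Reaches.mul rfl (Nat.le_of_ble_eq_true rfl)
        (show (i + s) * (T.length + 1) < _ by omega)
      (Reaches.add rfl (Nat.le_of_ble_eq_true rfl)
        (show (i + s) * (T.length + 1) + 4 * (T.length + 1) < _ by omega)
      (Reaches.add rfl (Nat.le_of_ble_eq_true rfl) (show i + (m + 1) < _ by omega)
      (Reaches.sub rfl (Nat.le_of_ble_eq_true rfl) (show s ≤ i + (m + 1) by omega)
        (show i + (m + 1) < _ by omega)
      (Reaches.add rfl (Nat.le_of_ble_eq_true rfl) (show (i + s) * (T.length + 1) +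
        4 * (T.length + 1) + (i + (m + 1) - s) < _ by omega)
      (Reaches.store rfl (Reaches.jump rfl (Reaches.done ?_))))))))))
    refine h _ _ (LoopInv.of_isGreatest (hinv.toMemInv.succ_of_bordered hm hg hs hs0) hm hg)
      (hL.succ_of_not_isRoot fun hr => ?_) _ _ _ _ _ _ _
    have := hr.2.2.2.2
    rw [Nat.add_sub_cancel_left] at this
    omega
  refine Finishes.of_reaches (Reaches.add rfl (Nat.le_of_ble_eq_true rfl) (show m + 1 < _ by omega)
    (Reaches.add rfl (Nat.le_of_ble_eq_true rfl) (show b + 1 < _ by omega)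
    (Reaches.add rfl (Nat.le_of_ble_eq_true rfl) (show T.length + 1 + (m + 1) < _ by omega)
    (Reaches.store rfl
    (Reaches.add rfl (Nat.le_of_ble_eq_true rfl) (show 2 * (T.length + 1) + (b + 1) < _ by omega)
    (Reaches.load rfl (Nat.le_of_ble_eq_true rfl) hload (by omega) ?_))))))
  rcases Nat.eq_zero_or_pos v with h0 | h0
  · rw [if_pos h0] at hsb
    rw [h0]
    exact Reaches.jumpLt_of_not_lt rfl (lt_irrefl 0) (Reaches.copy rfl
      (Nat.le_of_ble_eq_true rfl) (show b + 1 < _ by omega) (tail (b + 1) _ hsb (by omega)))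
  · rw [if_neg h0.ne'] at hsb
    exact Reaches.jumpLt rfl h0 ((tail v _ hsb h0).mono (by omega))

/-- Every pass lowers the potential. A fallback lowers `b`; a match lowers the middle term by 2 and
raises `b` by 1; a prefix without border lowers the middle term and leaves `b = 0`; for the next
suffix the first term drops by `2 * T.length + 2`, more than the middle term regains. A pass takes
fewer than 30 steps apart from writing. -/
theorem loopFinishes (hw : (T.length + 8) ^ 2 ≤ 2 ^ w) (hT : ∀ a ∈ T, a < 2 ^ w) (i m b : ℕ) :
    LoopFinishes w T i m b
      (30 * ((T.length - i) * (2 * T.length + 2) + 2 * (T.length - (i + m)) + b) + 10) := by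
  induction hM : (T.length - i) * (2 * T.length + 2) + 2 * (T.length - (i + m)) + b
    using Nat.strong_induction_on generalizing i m b with
  | _ M ih =>
  have h4 := lt_two_pow hw
  intro mem L hinv hL r₁₀ r₁₁ r₁₂ r₁₃ r₁₄ r₁₅ r₁₆
  have hle := hinv.le
  by_cases hend : i + m = T.length
  · refine Finishes.mono (B := 30 * M + 4 + 4 + 2) (Finishes.of_reaches
      (Reaches.add rfl (Nat.le_of_ble_eq_true rfl) (show i + m < _ by omega)
      (Reaches.jumpEq rfl hend (Reaches.done (finishes_next hw (fun hi => ?_) hinv hL hend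
        _ _ _ _ _ _ _))))) (by omega)
    have h5 : (T.length - i) * (2 * T.length + 2) =
          (T.length - (i + 1)) * (2 * T.length + 2) + (2 * T.length + 2) := by
        rw [show T.length - i = T.length - (i + 1) + 1 by omega, Nat.add_mul, Nat.one_mul]
    intro mem' L' h6 h7 s₁₀ s₁₁ s₁₂ s₁₃ s₁₄ s₁₅ s₁₆
    exact (ih _ (by omega) (i + 1) 0 0 rfl mem' L' h6 h7 s₁₀ s₁₁ s₁₂ s₁₃ s₁₄ s₁₅ s₁₆).mono (by omega)
  have hlt : i + m < T.length := by omega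
  have hmis : (m = 0 ∨ b = 0 ∧ T[i + b]? ≠ T[i + m]?) →
      LoopFinishes w T i (m + 1) 0 (30 * (M - 1) + 10) := by
    intro h0 mem' L' h6 h7 s₁₀ s₁₁ s₁₂ s₁₃ s₁₄ s₁₅ s₁₆
    exact (ih _ (by omega) i (m + 1) 0 rfl mem' L' h6 h7 s₁₀ s₁₁ s₁₂ s₁₃ s₁₄ s₁₅ s₁₆).mono
      (by omega)
  rcases Nat.eq_zero_or_pos m with hm0 | hm0
  · have hb0 := hinv.zero hm0
    have hne := hinv.unbordered (Or.inl hm0)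
    have hfin := hmis (Or.inl hm0)
    subst hb0
    refine Finishes.mono (B := 30 * (M - 1) + 10 + 6 + 3) (Finishes.of_reaches
      (Reaches.add rfl (Nat.le_of_ble_eq_true rfl) (show i + m < _ by omega)
      (Reaches.jumpEq_of_ne rfl hend (Reaches.jumpEq rfl hm0 (Reaches.done
        (finishes_unbordered hw hfin hinv hL hlt hne _ _ _ _ _ _ _)))))) (by omega)
  have hbm := (hinv.border hm0).1
  have hT' : ∀ p < T.length, T.getD p 0 < 2 ^ w := fun p hp => by
    rw [List.getD_eq_getElem _ _ hp]
    exact hT _ (List.getElem_mem hp)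
  refine Finishes.mono (B := 30 * (M - 1) + 10 + 20 + 8) (Finishes.of_reaches
    (Reaches.add rfl (Nat.le_of_ble_eq_true rfl) (show i + m < _ by omega)
    (Reaches.jumpEq_of_ne rfl hend (Reaches.jumpEq_of_ne rfl hm0.ne'
    (Reaches.add rfl (Nat.le_of_ble_eq_true rfl) (show i + b < _ by omega)
    (Reaches.add rfl (Nat.le_of_ble_eq_true rfl) (show i + b + 1 < _ by omega)
    (Reaches.load rfl (Nat.le_of_ble_eq_true rfl) (hinv.input (i + b) (by omega))
      (hT' _ (by omega))
    (Reaches.add rfl (Nat.le_of_ble_eq_true rfl) (show i + m + 1 < _ by omega)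
    (Reaches.load rfl (Nat.le_of_ble_eq_true rfl) (hinv.input (i + m) hlt) (hT' _ hlt)
    (Reaches.done ?_))))))))))  (by omega)
  by_cases heq : T[i + b]? = T[i + m]?
  · have heq' := (getD_eq_getD_iff (by omega) hlt).2 heq
    refine Finishes.mono (B := 30 * (M - 1) + 10 + 18 + 1) (Finishes.of_reaches
      (Reaches.jumpEq rfl heq' (Reaches.done
      (finishes_bordered hw (fun mem' L' h6 h7 s₁₀ s₁₁ s₁₂ s₁₃ s₁₄ s₁₅ s₁₆ => ?_) hinv hL hlt hm0
      heq _ _ _ _ _ _ _)))) (by omega)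
    exact (ih _ (by omega) i (m + 1) (b + 1) rfl mem' L' h6 h7 s₁₀ s₁₁ s₁₂ s₁₃ s₁₄ s₁₅ s₁₆).mono
      (by omega)
  have heq' := fun h => heq ((getD_eq_getD_iff (by omega) hlt).1 h)
  rcases Nat.eq_zero_or_pos b with hb0 | hb0
  · have hne := hinv.unbordered (Or.inr ⟨hb0, heq⟩)
    have hfin := hmis (Or.inr ⟨hb0, heq⟩)
    subst hb0
    exact Finishes.mono (B := 30 * (M - 1) + 10 + 6 + 2) (Finishes.of_reaches
      (Reaches.jumpEq_of_ne rfl heq' (Reaches.jumpEq rfl rfl (Reaches.done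
      (finishes_unbordered hw hfin hinv hL hlt hne _ _ _ _ _ _ _))))) (by omega)
  · obtain ⟨hinv', hlt'⟩ := hinv.fallback hm0 hb0 heq
    refine Finishes.mono (B := 30 * (M - 1) + 10 + 5) (Finishes.of_reaches
      (Reaches.jumpEq_of_ne rfl heq' (Reaches.jumpEq_of_ne rfl hb0.ne'
      (Reaches.add rfl (Nat.le_of_ble_eq_true rfl) (show T.length + 1 + b < _ by omega)
      (Reaches.load rfl (Nat.le_of_ble_eq_true rfl) rfl (hlt'.trans (by omega))
      (Reaches.jump rfl (Reaches.done ?_))))))) (by omega)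
    exact (ih _ (by omega) i m _ rfl _ _ hinv' hL _ _ _ _ _ _ _).mono (by omega)

end WordRAM

/-! ### Initialization and the final bound -/

namespace WordRAM

open BlockPal

variable {w : ℕ} {T : List ℕ}

theorem finishes_init (hw : (T.length + 8) ^ 2 ≤ 2 ^ w) (hT : ∀ a ∈ T, a < 2 ^ w) :
    Finishes w T []
      (30 * (T.length * (2 * T.length + 2) + 2 * T.length) + 10 + 7) (init T) := by
  have h4 := lt_two_pow hw
  have hinv : LoopInv T 0 0 0 (init T).mem :=
    ⟨memInv_init T, Nat.zero_le _, fun _ => rfl, fun h => absurd h (lt_irrefl 0),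
      fun h => absurd h (lt_irrefl 0)⟩
  have hL : FoundBefore T 0 (0 + 1) [] := by
    refine ⟨List.nodup_nil, fun p => ?_⟩
    simp only [List.not_mem_nil, false_iff]
    rintro ⟨h1, h2⟩
    have := h1.2.2.1
    omega
  have hinit : init T = ⟨0, regs [0, 0, 0, 0, 0, 0, 0, 0, 0, 0, 0, 0, 0, 0, 0, 0, 0],
      (init T).mem, written T []⟩ := by
    rw [init, State.mk.injEq]
    refine ⟨rfl, funext fun n => ?_, rfl, rfl⟩
    change 0 = (List.replicate 17 0).getD n 0
    rw [List.getD_eq_getElem?_getD, List.getElem?_replicate]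
    split_ifs <;> rfl
  have h2 : T.length + 1 + (T.length + 1) = 2 * (T.length + 1) := by omega
  have h3 : T.length + 1 + (T.length + 1) + (T.length + 1) = 3 * (T.length + 1) := by omega
  have h5 : T.length + 1 + (T.length + 1) + (T.length + 1) + (T.length + 1) =
    4 * (T.length + 1) := by omega
  have hfin := loopFinishes hw hT 0 0 0 _ _ hinv hL 0 0 0 0 0 0 0
  -- The program computes the starts of the rows by repeated addition, whereas `frame` records them
  -- as multiples.
  rw [frame, ← h2, ← h3, ← h5] at hfin
  rw [hinit]
  exact Finishes.of_reaches (Reaches.const rfl (Nat.le_of_ble_eq_true rfl) (by omega)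
    (Reaches.load rfl (Nat.le_of_ble_eq_true rfl) (v := T.length) rfl (by omega)
    (Reaches.add rfl (Nat.le_of_ble_eq_true rfl) (show T.length + 1 < _ by omega)
    (Reaches.add rfl (Nat.le_of_ble_eq_true rfl)
      (show T.length + 1 + (T.length + 1) < _ by omega)
    (Reaches.add rfl (Nat.le_of_ble_eq_true rfl)
      (show T.length + 1 + (T.length + 1) + (T.length + 1) < _ by omega)
    (Reaches.add rfl (Nat.le_of_ble_eq_true rfl)
      (show T.length + 1 + (T.length + 1) + (T.length + 1) + (T.length + 1) < _ by omega)
    (Reaches.jump rfl (Reaches.done hfin))))))))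

theorem cost_eq {L : List (ℕ × ℕ)} (hnd : L.Nodup) (hL : ∀ p, p ∈ L ↔ IsRoot T p.1 p.2) :
    cost T L = 21 * totalSize T + 21 * L.length := by
  rw [cost, List.sum_map_add, List.sum_map_mul_left, ← totalSize_eq_sum hnd hL, List.map_const',
    List.sum_replicate, smul_eq_mul, Nat.mul_comm L.length]

end WordRAM

/-- There is a fixed word RAM program that, on every string `T` of length `N` over an integer
alphabet whose letters fit into a machine word, the word length being at least a constant multiple
of `log N`, writes out every maximal block palindrome in `T` exactly once and halts within
`O(N + ‖MBP(T)‖)` steps. -/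
theorem theorem2 :
    ∃ (P : WordRAM.Program) (C e : ℕ), ∀ (w : ℕ) (T : List ℕ),
      (T.length + 2) ^ e ≤ 2 ^ w → (∀ a ∈ T, a < 2 ^ w) →
      ∃ L : List (ℕ × BlockPal ℕ),
        L.Nodup ∧ (∀ o, o ∈ L ↔ o ∈ BlockPal.MBP T) ∧
        WordRAM.HaltsWithin w P T (C * (T.length + BlockPal.totalSize T + 1))
          (L.flatMap BlockPal.encode) := by
  -- The exponent 6 works because `(N + 2) ^ 3 ≥ N + 8`. With `S = totalSize T`, the two counting
  -- bounds turn the step count into at most `282 S + 201 N + 17`, so 400 suffices.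
  refine ⟨WordRAM.prog, 400, 6, fun w T hw hT => ?_⟩
  have hw' : (T.length + 8) ^ 2 ≤ 2 ^ w := by
    refine le_trans ?_ hw
    rw [show 6 = 3 * 2 from rfl, pow_mul]
    refine Nat.pow_le_pow_left ?_ 2
    ring_nf
    omega
  obtain ⟨k, L, hnd, hL, hk, hpc, hout⟩ := WordRAM.finishes_init hw' hT
  refine ⟨L.map fun p => BlockPal.mbp T p.1 p.2, BlockPal.nodup_map_mbp hnd hL,
    BlockPal.mem_map_mbp hL, k, ?_, hpc, ?_⟩
  · have h1 := BlockPal.mul_succ_le_totalSize hnd hL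
    have h2 := BlockPal.length_le_totalSize_add hnd hL
    rw [WordRAM.cost_eq hnd hL] at hk
    have h3 : T.length * (2 * T.length + 2) = 2 * (T.length * (T.length + 1)) := by ring
    rw [h3] at hk
    omega
  · rw [hout, WordRAM.written, List.flatMap_map]
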